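/- Let $r\ge 2$, $q=e^{\pi \mathsf i/r}$, $q^{1/2}=e^{\pi\mathsf i/2r}$, $s=q^{r-1}$, and write $\{x\}=q^x-q^{-x}$, $[x]=\{x\}/\{1\}$, $\{a\}!=\{a\}\{a-1\}\cdots\{1\}$. Let $\mathsf V=\mathsf V_{r-1}$ be the $r$-dimensional complex vector space with basis $u_0,\dots,u_{r-1}$ and operators $$k\,u_m=q^{(r-1-2m)/2}u_m,\qquad E\,u_m=u_{m-1},\qquad F\,u_m=[m+1][r-1-m]\,u_{m+1},\qquad u_{-1}=u_r=0 .$$ Let $n\ge 1$. On $\mathsf V^{\otimes n}$ let $E$ and $F$ act by $$E=\sum_{i=1}^n 1^{\otimes i-1}\otimes E\otimes (k^2)^{\otimes n-i},\qquad F=\sum_{i=1}^n (k^{-2})^{\otimes i-1}\otimes F\otimes 1^{\otimes n-i}.$$ For $\ell\in\mathbb N$ let $\boldsymbol V_{n,\ell}\subset \mathsf V^{\otimes n}$ be the span of the vectors $u_{\varepsilon_1}\otimes\cdots\otimes u_{\varepsilon_n}$ with $\varepsilon_1+\cdots+\varepsilon_n=\ell$ (equivalently, the eigenspace for the eigenvalue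 $n(r-1)-2\ell$ of $\sum_i 1^{\otimes i-1}\otimes H\otimes 1^{\otimes n-i}$, where $H u_m=(r-1-2m)u_m$), and put $$\boldsymbol W_{n,\ell}=\ker E\cap \boldsymbol V_{n,\ell},\qquad \boldsymbol N_{n,\ell}=\ker (FE)^2\cap \boldsymbol V_{n,\ell}.$$ Let $$R=\frac1{4r}\sum_{a=0}^{r-1}\sum_{m,m'=0}^{4r-1}\frac{\{1\}^{2a}}{\{a\}!}\,q^{a(a-1)/2+a(m-m')-mm'/2}\;E^ak^m\otimes F^ak^{m'},\qquad \mathsf R=q^{-(r-1)^2/2}\,\tau\circ R$$ on $\mathsf V\otimes\mathsf V$, where $\tau$ is the flip. Then the operators $1^{\otimes i-1}\otimes\mathsf R\otimes 1^{\otimes n-i-1}$, $1\le i\le n-1$, define a representation of the braid group $B_n$ (with Artin generators $\sigma_1,\dots,\sigma_{n-1}$) on $\mathsf V^{\otimes n}$, for which $\boldsymbol W_{n,\ell}$ and $\boldsymbol N_{n,\ell}$ are subrepresentations. Let $\delta_i=\sigma_1\sigma_2\cdots\sigma_{i-1}$ for $2\le i\le n$, let $\Delta_n=\delta_n\delta_{n-1}\cdots\delta_2$,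 and let $\theta_n=\Delta_n^2$ be the full twist. Let $0\le j<r$ be the solution of $j\equiv n+2(\ell-1) \bmod r$ and let $\ell'=\ell-1-j\in\mathbb Z$. Then: 1. If $j<r-1$, the full twist acts on $\boldsymbol N_{n,\ell}$ by $$\theta_n=q^{2\ell(n+\ell-1)}\Bigl(\mathrm{Id}+s^n q^{1-\ell-\ell'}(\ell-\ell')\frac{\{1\}^2}{\{\ell-\ell'\}}\,FE\Bigr).$$ If $j=r-1$ (so that $\{\ell-\ell'\}=\{r\}=0$), then $FE$ vanishes on $\boldsymbol N_{n,\ell}$ and $\theta_n$ acts on $\boldsymbol N_{n,\ell}$ by the scalar $q^{2\ell(n+\ell-1)}$. 2. The full twist acts on $\boldsymbol W_{n,\ell}$ by the scalar $q^{2\ell(n+\ell-1)}$, whose $r$-th power is $1$. Hence $\theta_n^r$ acts trivially on $\boldsymbol W_{n,\ell}$, and if $n\ge 2$, the representation $\boldsymbol W_{n,\ell}$ of $B_n$ is not faithful. -/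

import Mathlib

noncomputable section

/-! ### The Artin braid group -/

/-- Artin's relators on the generators `σ_1, …, σ_{n-1}`; the index `i : Fin (n - 1)` stands for
the generator `σ_{i+1}`. -/
def braidRels (n : ℕ) : Set (FreeGroup (Fin (n - 1))) :=
  {x | ∃ i j : Fin (n - 1), (i : ℕ) + 1 < j ∧
      x = FreeGroup.of i * FreeGroup.of j * (FreeGroup.of j * FreeGroup.of i)⁻¹} ∪
  {x | ∃ i j : Fin (n - 1), (i : ℕ) + 1 = j ∧
      x = FreeGroup.of i * FreeGroup.of j * FreeGroup.of i *
        (FreeGroup.of j * FreeGroup.of i * FreeGroup.of j)⁻¹}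

/-- The braid group `B_n` on `n` strands. -/
abbrev BraidGroup (n : ℕ) : Type := PresentedGroup (braidRels n)

namespace BraidGroup

/-- The generator `σ_{i+1}` of `B_n`. -/
def gen (n : ℕ) (i : Fin (n - 1)) : BraidGroup n := PresentedGroup.of i

/-- `δ_i = σ_1 σ_2 ⋯ σ_{i-1}` for `2 ≤ i ≤ n`. -/
def delta (n i : ℕ) : BraidGroup n :=
  (((List.finRange (n - 1)).take (i - 1)).map (gen n)).prod

/-- The half twist `Δ_n = δ_n δ_{n-1} ⋯ δ_2`. -/
def halfTwist (n : ℕ) : BraidGroup n :=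
  ((List.range (n - 1)).map fun t => delta n (n - t)).prod

/-- The full twist `θ_n = Δ_n ^ 2`. -/
def fullTwist (n : ℕ) : BraidGroup n := halfTwist n ^ 2

end BraidGroup

namespace Steinberg

/-! ### Quantum numbers at the root of unity -/

/-- `q^{1/2} = exp(π i / (2r))`. -/
def qHalf (r : ℕ) : ℂ := Complex.exp (Real.pi * Complex.I / (2 * r))

/-- `q = exp(π i / r)`. -/
def q (r : ℕ) : ℂ := Complex.exp (Real.pi * Complex.I / r)

/-- `s = q^{r-1}`. -/
def s (r : ℕ) : ℂ := q r ^ (r - 1)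

/-- `{x} = q^x - q^{-x}`. -/
def qNum (r : ℕ) (x : ℤ) : ℂ := q r ^ x - q r ^ (-x)

/-- `[x] = {x} / {1}`. -/
def qInt (r : ℕ) (x : ℤ) : ℂ := qNum r x / qNum r 1

/-- `{a}! = {a} {a-1} ⋯ {1}`. -/
def qNumFactorial (r a : ℕ) : ℂ := ∏ t ∈ Finset.range a, qNum r (t + 1)

/-! ### The Steinberg module `V_{r-1}` with the actions of `E`, `F`, `k`, `k⁻¹` and of the strong
weight operator `H` -/

/-- The underlying space of the `r`-dimensional module `V_{r-1}`. -/
abbrev V (r : ℕ) : Type := Fin r → ℂ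

/-- The basis vector `u_m`, `0 ≤ m ≤ r - 1`; it is `0` for `m ≥ r`. -/
def u (r m : ℕ) : V r := fun t => if (t : ℕ) = m then 1 else 0

/-- The endomorphism of `V_{r-1}` with `u_m ↦ f m` for `0 ≤ m ≤ r - 1`. -/
def onBasis (r : ℕ) (f : ℕ → V r) : Module.End ℂ (V r) :=
  (Pi.basisFun ℂ (Fin r)).constr ℂ fun m => f m

/-- `E u_m = u_{m-1}`, with `u_{-1} = 0`. -/
def opE (r : ℕ) : Module.End ℂ (V r) :=
  onBasis r fun m => if m = 0 then 0 else u r (m - 1)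

/-- `F u_m = [m+1] [r-1-m] u_{m+1}`, with `u_r = 0`. -/
def opF (r : ℕ) : Module.End ℂ (V r) :=
  onBasis r fun m => (qInt r (m + 1) * qInt r ((r : ℤ) - 1 - m)) • u r (m + 1)

/-- `k u_m = q^{(r-1-2m)/2} u_m`. -/
def opK (r : ℕ) : Module.End ℂ (V r) :=
  onBasis r fun m => (qHalf r ^ ((r : ℤ) - 1 - 2 * m)) • u r m

/-- `k⁻¹ u_m = q^{-(r-1-2m)/2} u_m`. -/
def opKInv (r : ℕ) : Module.End ℂ (V r) :=
  onBasis r fun m => (qHalf r ^ (-((r : ℤ) - 1 - 2 * m))) • u r m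

/-- `H u_m = (r-1-2m) u_m`. -/
def opH (r : ℕ) : Module.End ℂ (V r) :=
  onBasis r fun m => ((r : ℂ) - 1 - 2 * m) • u r m

/-! ### The tensor power `V_{r-1}^{⊗ n}` -/

/-- `V_{r-1}^{⊗ n}`. -/
abbrev TensorPow (n r : ℕ) : Type := PiTensorProduct ℂ fun _ : Fin n => V r

/-- `∑_i a^{⊗ (i-1)} ⊗ x ⊗ b^{⊗ (n-i)}`. -/
def sumInsert (n r : ℕ) (a x b : Module.End ℂ (V r)) : Module.End ℂ (TensorPow n r) :=
  ∑ i : Fin n, PiTensorProduct.map fun p : Fin n => if p < i then a else if p = i then x else b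

/-- The action of `E` on `V_{r-1}^{⊗ n}`, through the iterated coproduct of
`Δ(E) = 1 ⊗ E + E ⊗ k²`. -/
def tensorE (n r : ℕ) : Module.End ℂ (TensorPow n r) := sumInsert n r 1 (opE r) (opK r ^ 2)

/-- The action of `F` on `V_{r-1}^{⊗ n}`, through the iterated coproduct of
`Δ(F) = k⁻² ⊗ F + F ⊗ 1`. -/
def tensorF (n r : ℕ) : Module.End ℂ (TensorPow n r) := sumInsert n r (opKInv r ^ 2) (opF r) 1

/-- The operator `H_n = ∑_i 1^{⊗ (i-1)} ⊗ H ⊗ 1^{⊗ (n-i)}`. -/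
def tensorH (n r : ℕ) : Module.End ℂ (TensorPow n r) := sumInsert n r 1 (opH r) 1

/-- The strong weight space `V_{n,ℓ} = ker (H_n - (n(r-1) - 2ℓ))`. -/
def weightSpace (n r ℓ : ℕ) : Submodule ℂ (TensorPow n r) :=
  LinearMap.ker (tensorH n r - ((n : ℂ) * ((r : ℂ) - 1) - 2 * ℓ) • 1)

/-- The highest strong weight space `W_{n,ℓ} = ker E ∩ V_{n,ℓ}`. -/
def highestWeightSpace (n r ℓ : ℕ) : Submodule ℂ (TensorPow n r) :=
  LinearMap.ker (tensorE n r) ⊓ weightSpace n r ℓ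

/-- The dominant space `N_{n,ℓ} = ker (FE)² ∩ V_{n,ℓ}`. -/
def dominantSpace (n r ℓ : ℕ) : Submodule ℂ (TensorPow n r) :=
  LinearMap.ker ((tensorF n r * tensorE n r) ^ 2) ⊓ weightSpace n r ℓ

/-! ### The braiding -/

/-- The coefficient of `E^a k^m ⊗ F^a k^{m'}` in the universal `R`-matrix
`R = (1/4r) ∑_{a=0}^{r-1} ∑_{m,m'=0}^{4r-1}
  ({1}^{2a} / {a}!) q^{a(a-1)/2 + a(m-m') - m m'/2} E^a k^m ⊗ F^a k^{m'}`. -/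
def coeffR (r a m m' : ℕ) : ℂ :=
  1 / (4 * r) * (qNum r 1 ^ (2 * a) / qNumFactorial r a) *
    qHalf r ^ ((a : ℤ) * (a - 1) + 2 * a * ((m : ℤ) - m') - m * m')

/-- The position `i` (of `0, …, n - 1`) of the left strand of the crossing `σ_{i+1}`. -/
def leftPos {n : ℕ} (i : Fin (n - 1)) : Fin n := ⟨i, by omega⟩

/-- The position of the right strand of the crossing `σ_{i+1}`. -/
def rightPos {n : ℕ} (i : Fin (n - 1)) : Fin n := ⟨i + 1, by omega⟩

/-- `1 ⊗ ⋯ ⊗ 1 ⊗ x ⊗ y ⊗ 1 ⊗ ⋯ ⊗ 1` with `x`, `y` on the two strands of the crossing. -/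
def twoLegs {n : ℕ} (r : ℕ) (i : Fin (n - 1)) (x y : Module.End ℂ (V r)) :
    Module.End ℂ (TensorPow n r) :=
  PiTensorProduct.map fun p : Fin n => if p = leftPos i then x else if p = rightPos i then y else 1

/-- `R` acting on the two adjacent tensor factors of the crossing. -/
def tensorR {n : ℕ} (r : ℕ) (i : Fin (n - 1)) : Module.End ℂ (TensorPow n r) :=
  ∑ a ∈ Finset.range r, ∑ m ∈ Finset.range (4 * r), ∑ m' ∈ Finset.range (4 * r),
    coeffR r a m m' • twoLegs r i (opE r ^ a * opK r ^ m) (opF r ^ a * opK r ^ m')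

/-- The flip `τ` of the two adjacent tensor factors of the crossing. -/
def tensorFlip {n : ℕ} (r : ℕ) (i : Fin (n - 1)) : Module.End ℂ (TensorPow n r) :=
  (PiTensorProduct.reindex ℂ (fun _ : Fin n => V r)
    (Equiv.swap (leftPos i) (rightPos i))).toLinearMap

/-- The operator `1^{⊗ i} ⊗ 𝖱 ⊗ 1^{⊗ (n-i-2)}` by which the generator `σ_{i+1}` acts, where
`𝖱 = q^{-(r-1)²/2} τ ∘ R` on `V_{r-1} ⊗ V_{r-1}`. -/
def sigmaOp (n r : ℕ) (i : Fin (n - 1)) : Module.End ℂ (TensorPow n r) :=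
  qHalf r ^ (-((r : ℤ) - 1) ^ 2) • (tensorFlip r i * tensorR r i)

end Steinberg

end

/-!
The operators `E` and `F` on `V_{r-1}^{⊗ n}` commute with the braid operators, and `u_0` generates
`V_{r-1}` under `F`. So an identity between operators commuting with `F` need only be checked when
the first tensor factor is `u_0`, where `𝖱` reduces to the flip up to a scalar; this gives the braid
relations.

On a vector `u_0 ⊗ x`, winding the first strand once around the others produces a combination of the
vectors `F^c u_0 ⊗ E^c x`. Induction on the number of strands then shows that the full twist acts
on vectors of degree `ℓ` as `∑_a t_a F^a E^a` with explicit scalars `t_a`. On `ker (FE)²` the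
commutation relation of `E` and `F` turns every `F^a E^a` with `a ≥ 1` into an explicit multiple of
`FE`, and the resulting sum telescopes. If `j = r - 1`, the multiple for `a = r` is nonzero while
`E^r = 0`, which forces `FE = 0`.

The representation on `W_{n,ℓ}` is not faithful because the exponent sum `B_n → ℤ` shows that the
full twist has infinite order.
-/

namespace Steinberg

/-! ### Quantum numbers at a root of unity -/

theorem sum_range_zpow_of_isPrimitiveRoot {K : Type*} [Field K] {ζ : K} {N : ℕ}
    (hζ : IsPrimitiveRoot ζ N) (y : ℤ) :
    ∑ t ∈ Finset.range N, ζ ^ ((t : ℤ) * y) = if (N : ℤ) ∣ y then (N : K) else 0 := by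
  have hpow : ∀ t : ℕ, ζ ^ ((t : ℤ) * y) = (ζ ^ y) ^ t := fun t => by
    rw [mul_comm, zpow_mul, zpow_natCast]
  simp_rw [hpow]
  split_ifs with hy
  · simp [(hζ.zpow_eq_one_iff_dvd y).2 hy]
  · rw [geom_sum_eq (mt (hζ.zpow_eq_one_iff_dvd y).1 hy), ← zpow_natCast, ← zpow_mul,
      (hζ.zpow_eq_one_iff_dvd _).2 (dvd_mul_left _ _), sub_self, zero_div]

section Scalars

theorem qHalf_ne_zero (r : ℕ) : qHalf r ≠ 0 := Complex.exp_ne_zero _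

theorem q_eq_qHalf_sq (r : ℕ) : q r = qHalf r ^ 2 := by
  rw [q, qHalf, ← Complex.exp_nat_mul]
  congr 1
  push_cast
  ring

theorem q_zpow (r : ℕ) (x : ℤ) : q r ^ x = qHalf r ^ (2 * x) := by
  rw [q_eq_qHalf_sq, zpow_mul]
  norm_cast

theorem qNum_eq (r : ℕ) (x : ℤ) : qNum r x = qHalf r ^ (2 * x) - qHalf r ^ (-(2 * x)) := by
  rw [qNum, q_zpow, q_zpow, mul_neg]

theorem qNum_mul_qNum (r : ℕ) (x y : ℤ) :
    qNum r x * qNum r y = (qHalf r ^ (2 * (x + y)) + qHalf r ^ (-(2 * (x + y)))) -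
      (qHalf r ^ (2 * (x - y)) + qHalf r ^ (-(2 * (x - y)))) := by
  have h0 := qHalf_ne_zero r
  rw [qNum_eq, qNum_eq, sub_mul, mul_sub, mul_sub, ← zpow_add₀ h0, ← zpow_add₀ h0,
    ← zpow_add₀ h0, ← zpow_add₀ h0]
  ring_nf

@[simp]
theorem qNum_zero (r : ℕ) : qNum r 0 = 0 := by simp [qNum]

theorem qNum_neg (r : ℕ) (x : ℤ) : qNum r (-x) = -qNum r x := by
  rw [qNum, qNum, neg_neg, neg_sub]

@[simp]
theorem qInt_zero (r : ℕ) : qInt r 0 = 0 := by simp [qInt]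

theorem qInt_neg (r : ℕ) (x : ℤ) : qInt r (-x) = -qInt r x := by
  rw [qInt, qInt, qNum_neg, neg_div]

@[simp]
theorem qNumFactorial_zero (r : ℕ) : qNumFactorial r 0 = 1 := Finset.prod_range_zero _

theorem qNumFactorial_succ (r a : ℕ) :
    qNumFactorial r (a + 1) = qNumFactorial r a * qNum r (a + 1) :=
  Finset.prod_range_succ _ _

variable {r : ℕ}

section NeZero

variable [NeZero r]

theorem isPrimitiveRoot_qHalf : IsPrimitiveRoot (qHalf r) (4 * r) := by
  have hr : (r : ℂ) ≠ 0 := NeZero.ne _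
  convert Complex.isPrimitiveRoot_exp (4 * r) (mul_ne_zero four_ne_zero (NeZero.ne r)) using 1
  rw [qHalf]
  congr 1
  push_cast
  field_simp
  norm_num

theorem qHalf_zpow_eq_one_iff (x : ℤ) : qHalf r ^ x = 1 ↔ (4 * r : ℤ) ∣ x := by
  exact_mod_cast isPrimitiveRoot_qHalf.zpow_eq_one_iff_dvd x

theorem qHalf_pow_two_mul : qHalf r ^ (2 * r) = -1 := by
  have hr : (r : ℂ) ≠ 0 := NeZero.ne _
  rw [qHalf, ← Complex.exp_nat_mul, ← Complex.exp_pi_mul_I]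
  congr 1
  push_cast
  field_simp

theorem qHalf_zpow_add_two_mul (x : ℤ) : qHalf r ^ (x + 2 * r) = -qHalf r ^ x := by
  have h := zpow_natCast (qHalf r) (2 * r)
  rw [qHalf_pow_two_mul] at h
  push_cast at h
  rw [zpow_add₀ (qHalf_ne_zero r), h, mul_neg_one]

theorem qHalf_zpow_add_four_mul (x t : ℤ) : qHalf r ^ (x + 4 * r * t) = qHalf r ^ x := by
  rw [zpow_add₀ (qHalf_ne_zero r), (qHalf_zpow_eq_one_iff _).2 (dvd_mul_right _ t), mul_one]

theorem qNum_eq_zero_iff (x : ℤ) : qNum r x = 0 ↔ (r : ℤ) ∣ x := by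
  have h0 := qHalf_ne_zero r
  have hfactor : qNum r x = qHalf r ^ (-(2 * x)) * (qHalf r ^ (4 * x) - 1) := by
    rw [qNum_eq, mul_sub, ← zpow_add₀ h0, mul_one]
    congr 2
    ring
  rw [hfactor, mul_eq_zero, or_iff_right (zpow_ne_zero _ h0), sub_eq_zero, qHalf_zpow_eq_one_iff]
  exact mul_dvd_mul_iff_left four_ne_zero

theorem qNum_ne_zero {x : ℤ} (h0 : 0 < x) (hx : x < r) : qNum r x ≠ 0 := fun h =>
  hx.not_ge (Int.le_of_dvd h0 ((qNum_eq_zero_iff x).1 h))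

theorem qNum_sub_left (x : ℤ) : qNum r (r - x) = qNum r x := by
  have h₁ := qHalf_zpow_add_two_mul (r := r) (-(2 * x))
  have h₂ := qHalf_zpow_add_two_mul (r := r) (-(2 * (r - x)))
  rw [show -(2 * ((r : ℤ) - x)) + 2 * r = 2 * x by ring] at h₂
  rw [qNum_eq, qNum_eq, h₂, show 2 * ((r : ℤ) - x) = -(2 * x) + 2 * r by ring, h₁]
  ring

theorem qInt_sub_left (x : ℤ) : qInt r (r - x) = qInt r x := by
  rw [qInt, qInt, qNum_sub_left]

@[simp]
theorem qInt_self : qInt r r = 0 := by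
  rw [qInt, (qNum_eq_zero_iff _).2 dvd_rfl, zero_div]

theorem qInt_succ_ne_zero {m : ℕ} (hm : m + 1 < r) : qInt r (m + 1) ≠ 0 :=
  div_ne_zero (qNum_ne_zero (by omega) (by omega)) (qNum_ne_zero (by omega) (by omega))

theorem qNumFactorial_ne_zero {a : ℕ} (ha : a < r) : qNumFactorial r a ≠ 0 := by
  refine Finset.prod_ne_zero_iff.2 fun t ht => qNum_ne_zero (by omega) ?_
  have := Finset.mem_range.1 ht
  omega

theorem qNumFactorial_self : qNumFactorial r r = 0 :=
  Finset.prod_eq_zero (Finset.mem_range.2 (Nat.sub_one_lt (NeZero.ne r)))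
    ((qNum_eq_zero_iff _).2 (by simp [Nat.cast_sub NeZero.one_le]))

end NeZero

section AtLeastTwo

variable [r.AtLeastTwo]

theorem qNum_one_ne_zero : qNum r 1 ≠ 0 :=
  qNum_ne_zero one_pos (by exact_mod_cast Nat.AtLeastTwo.one_lt)

@[simp]
theorem qInt_one : qInt r 1 = 1 := div_self qNum_one_ne_zero

theorem qInt_eq_zero_iff (x : ℤ) : qInt r x = 0 ↔ (r : ℤ) ∣ x := by
  rw [qInt, div_eq_zero_iff, or_iff_left qNum_one_ne_zero, qNum_eq_zero_iff]

theorem qInt_mul_qInt_add_qInt (a y : ℤ) :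
    qInt r (y + 2 * a) + qInt r a * qInt r (y + a - 1) = qInt r (a + 1) * qInt r (y + a) := by
  have h1 : qNum r 1 ≠ 0 := qNum_one_ne_zero
  have hnum : qNum r (y + 2 * a) * qNum r 1 + qNum r a * qNum r (y + a - 1) =
      qNum r (a + 1) * qNum r (y + a) := by
    simp only [qNum_mul_qNum]
    ring_nf
  simp only [qInt]
  field_simp
  linear_combination hnum

theorem qInt_sq_sub_qInt_sq (m : ℤ) :
    qInt r (m + 1) ^ 2 - qInt r m ^ 2 = qInt r (r - 1 - 2 * m) := by
  have h1 : qNum r 1 ≠ 0 := qNum_one_ne_zero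
  rw [show (r : ℤ) - 1 - 2 * m = r - (1 + 2 * m) by ring, qInt_sub_left, qInt, qInt, qInt]
  field_simp
  simp only [pow_two, qNum_mul_qNum]
  ring_nf

end AtLeastTwo

/-! ### The Cartan part of the `R`-matrix -/

theorem sum_range_coeffR [NeZero r] (a m' : ℕ) (w : ℤ) :
    ∑ m ∈ Finset.range (4 * r), coeffR r a m m' * qHalf r ^ ((m : ℤ) * w) =
      if (4 * r : ℤ) ∣ w + 2 * a - m' then
        qNum r 1 ^ (2 * a) / qNumFactorial r a * qHalf r ^ ((a : ℤ) * (a - 1) - 2 * a * m')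
      else 0 := by
  have hr : (r : ℂ) ≠ 0 := NeZero.ne _
  have hterm : ∀ m : ℕ, coeffR r a m m' * qHalf r ^ ((m : ℤ) * w) =
      1 / (4 * r) * (qNum r 1 ^ (2 * a) / qNumFactorial r a *
        qHalf r ^ ((a : ℤ) * (a - 1) - 2 * a * m')) * qHalf r ^ ((m : ℤ) * (w + 2 * a - m')) := by
    intro m
    rw [coeffR, ← mul_assoc (1 / _), mul_assoc _ (_ ^ _), mul_assoc _ (_ ^ _),
      ← zpow_add₀ (qHalf_ne_zero r), ← zpow_add₀ (qHalf_ne_zero r)]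
    congr 2
    ring
  simp_rw [hterm]
  rw [← Finset.mul_sum, sum_range_zpow_of_isPrimitiveRoot isPrimitiveRoot_qHalf]
  push_cast
  split_ifs
  · field_simp
  · rw [mul_zero]

/-- The sum over `m` in `sum_range_coeffR` selects the residue `m'` of `w + 2a` modulo `4r`. -/
theorem sum_range_sum_range_coeffR [NeZero r] (a : ℕ) (w w' : ℤ) :
    ∑ m ∈ Finset.range (4 * r), ∑ m' ∈ Finset.range (4 * r),
      coeffR r a m m' * (qHalf r ^ ((m : ℤ) * w) * qHalf r ^ ((m' : ℤ) * w')) =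
    qNum r 1 ^ (2 * a) / qNumFactorial r a *
      qHalf r ^ ((a : ℤ) * (a - 1) + (w + 2 * a) * (w' - 2 * a)) := by
  have hr := NeZero.pos r
  have hnonneg := Int.emod_nonneg (w + 2 * a) (by omega : (4 * r : ℤ) ≠ 0)
  have hlt := Int.emod_lt_of_pos (w + 2 * a) (by omega : (0 : ℤ) < 4 * r)
  obtain ⟨m₀, hm₀⟩ := Int.eq_ofNat_of_zero_le hnonneg
  rw [Finset.sum_comm]
  simp_rw [← mul_assoc, ← Finset.sum_mul, sum_range_coeffR]
  rw [Finset.sum_eq_single_of_mem m₀ (Finset.mem_range.2 (by omega))]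
  · obtain ⟨c, hc⟩ : (4 * r : ℤ) ∣ w + 2 * a - m₀ := hm₀ ▸ Int.dvd_self_sub_emod
    have hexp : (a : ℤ) * (a - 1) + (w + 2 * a) * (w' - 2 * a) =
        (a : ℤ) * (a - 1) - 2 * a * m₀ + m₀ * w' + 4 * r * (c * (w' - 2 * a)) := by
      linear_combination (w' - 2 * a) * hc
    rw [if_pos ⟨c, hc⟩, hexp, qHalf_zpow_add_four_mul, mul_assoc, ← zpow_add₀ (qHalf_ne_zero r)]
  · intro m' hm' hne
    rw [if_neg, zero_mul]
    intro hdvd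
    have hmod := Int.ModEq.eq (Int.modEq_iff_dvd.2 hdvd)
    rw [hm₀, Int.emod_eq_of_lt (by omega) (by have := Finset.mem_range.1 hm'; omega)] at hmod
    exact hne (by exact_mod_cast hmod)

end Scalars

/-! ### Splitting off the first tensor factor -/

section Cons

open PiTensorProduct TensorProduct

variable {R M N : Type*} [CommSemiring R] [AddCommMonoid M] [Module R M] [AddCommMonoid N]
  [Module R N] {n : ℕ}

/-- The bilinear map `M × M^{⊗ n} → M^{⊗ (n+1)}`, `(y, x) ↦ y ⊗ x`, through which statements about
tensor powers are proved by induction on the number of factors. -/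
noncomputable def cons :
    M →ₗ[R] (⨂[R] _ : Fin n, M) →ₗ[R] ⨂[R] _ : Fin (n + 1), M :=
  (lift (R := R) (s := fun _ : Fin n => M)).toLinearMap ∘ₗ
    (tprod R (s := fun _ : Fin (n + 1) => M)).curryLeft

theorem cons_tprod (y : M) (f : Fin n → M) :
    cons y (tprod R f) = tprod R (Fin.cons y f : Fin (n + 1) → M) := by
  simp [cons]

theorem hom_ext_cons {A B : (⨂[R] _ : Fin (n + 1), M) →ₗ[R] N}
    (h : ∀ (y : M) x, A (cons y x) = B (cons y x)) : A = B := by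
  refine PiTensorProduct.ext (MultilinearMap.ext fun f => ?_)
  simpa [cons_tprod] using h (f 0) (tprod R (Fin.tail f))

theorem map_cons (f : Fin (n + 1) → M →ₗ[R] M) (y : M) (x : ⨂[R] _ : Fin n, M) :
    map f (cons y x) = cons (f 0 y) (map (fun i => f i.succ) x) := by
  have h : map f ∘ₗ cons y = cons (f 0 y) ∘ₗ map fun i => f i.succ := by
    refine PiTensorProduct.ext (MultilinearMap.ext fun g => ?_)
    simp only [LinearMap.compMultilinearMap_apply, LinearMap.comp_apply, cons_tprod, map_tprod]
    congr 1
    ext i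
    refine Fin.cases ?_ (fun i => ?_) i <;> simp
  exact LinearMap.congr_fun h x

theorem reindex_cons {e : Equiv.Perm (Fin n)} {e' : Equiv.Perm (Fin (n + 1))} (h0 : e' 0 = 0)
    (hsucc : ∀ i, e' i.succ = (e i).succ) (y : M) (x : ⨂[R] _ : Fin n, M) :
    reindex R (fun _ => M) e' (cons y x) = cons y (reindex R (fun _ => M) e x) := by
  have h : (reindex R (fun _ => M) e').toLinearMap ∘ₗ cons y =
      cons y ∘ₗ (reindex R (fun _ => M) e).toLinearMap := by
    refine PiTensorProduct.ext (MultilinearMap.ext fun g => ?_)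
    simp only [LinearMap.compMultilinearMap_apply, LinearMap.comp_apply, cons_tprod,
      LinearEquiv.coe_coe, reindex_tprod]
    congr 1
    ext i
    refine Fin.cases ?_ (fun i => ?_) i
    · rw [(Equiv.symm_apply_eq e').2 h0.symm]
      rfl
    · rw [(Equiv.symm_apply_eq e').2 (by rw [hsucc, e.apply_symm_apply] :
        i.succ = e' (e.symm i).succ)]
      rfl
  exact LinearMap.congr_fun h x

theorem reindex_swap_cons_cons (y z : M) (x : ⨂[R] _ : Fin n, M) :
    reindex R (fun _ => M) (Equiv.swap 0 1) (cons y (cons z x)) = cons z (cons y x) := by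
  have h : (reindex R (fun _ => M) (Equiv.swap 0 1)).toLinearMap ∘ₗ cons y ∘ₗ cons (n := n) z =
      cons z ∘ₗ cons y := by
    refine PiTensorProduct.ext (MultilinearMap.ext fun g => ?_)
    simp only [LinearMap.compMultilinearMap_apply, LinearMap.comp_apply, cons_tprod,
      LinearEquiv.coe_coe, reindex_tprod, Equiv.symm_swap]
    congr 1
    ext i
    refine Fin.cases ?_ (Fin.cases ?_ fun i => ?_) i
    · rw [Equiv.swap_apply_left]
      rfl
    · rw [Fin.succ_zero_eq_one, Equiv.swap_apply_right]
      rfl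
    · rw [Equiv.swap_apply_of_ne_of_ne (Fin.succ_ne_zero _) (by simp [Fin.ext_iff])]
      rfl
  exact LinearMap.congr_fun h x

end Cons

/-! ### The operators on the basis of `V_{r-1}` -/

section Basis

theorem u_eq_basisFun (r : ℕ) (m : Fin r) : u r m = Pi.basisFun ℂ (Fin r) m := by
  ext t
  simp [u, Pi.single_apply, Fin.ext_iff]

theorem u_eq_zero {r m : ℕ} (h : r ≤ m) : u r m = 0 := by
  ext t
  have := t.2
  simp only [u, Pi.zero_apply, ite_eq_right_iff]
  omega

theorem end_ext_u {r : ℕ} {M : Type*} [AddCommMonoid M] [Module ℂ M] {A B : V r →ₗ[ℂ] M}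
    (h : ∀ m < r, A (u r m) = B (u r m)) : A = B :=
  (Pi.basisFun ℂ (Fin r)).ext fun m => by simpa only [← u_eq_basisFun] using h m m.2

theorem onBasis_u {r m : ℕ} (hm : m < r) (f : ℕ → V r) : onBasis r f (u r m) = f m := by
  rw [u_eq_basisFun r ⟨m, hm⟩, onBasis, Module.Basis.constr_basis]

theorem onBasis_smul_u (r m : ℕ) (c : ℕ → ℂ) (p : ℕ → ℕ) (hp : ∀ m, m ≤ p m) :
    onBasis r (fun m => c m • u r (p m)) (u r m) = c m • u r (p m) := by
  rcases lt_or_ge m r with h | h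
  · rw [onBasis_u h]
  · rw [u_eq_zero h, u_eq_zero (h.trans (hp m)), map_zero, smul_zero]

theorem opE_u_zero (r : ℕ) : opE r (u r 0) = 0 := by
  rcases Nat.eq_zero_or_pos r with h | h
  · rw [u_eq_zero h.le, map_zero]
  · rw [opE, onBasis_u h, if_pos rfl]

theorem opE_u_succ {r m : ℕ} (hm : m + 1 < r) : opE r (u r (m + 1)) = u r m := by
  rw [opE, onBasis_u hm, if_neg (Nat.succ_ne_zero m), Nat.add_sub_cancel]

theorem opF_u (r m : ℕ) [NeZero r] : opF r (u r m) = qInt r (m + 1) ^ 2 • u r (m + 1) := by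
  rw [opF, onBasis_smul_u r m _ _ Nat.le_succ, pow_two,
    ← qInt_sub_left ((m : ℤ) + 1), sub_sub, add_comm (1 : ℤ), qInt_sub_left]

theorem opK_pow_u (r m t : ℕ) :
    (opK r ^ t) (u r m) = qHalf r ^ ((t : ℤ) * ((r : ℤ) - 1 - 2 * m)) • u r m := by
  induction t with
  | zero => simp
  | succ t ih =>
    rw [pow_succ', Module.End.mul_apply, ih, map_smul, opK, onBasis_smul_u r m _ _ le_refl,
      smul_smul, ← zpow_add₀ (qHalf_ne_zero r)]
    congr 2
    push_cast
    ring

theorem opKInv_sq_u (r m : ℕ) :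
    (opKInv r ^ 2) (u r m) = qHalf r ^ (-2 * ((r : ℤ) - 1 - 2 * m)) • u r m := by
  rw [pow_two, Module.End.mul_apply, opKInv, onBasis_smul_u r m _ _ le_refl, map_smul,
    onBasis_smul_u r m _ _ le_refl, smul_smul, ← zpow_add₀ (qHalf_ne_zero r)]
  congr 2
  ring

theorem opH_u (r m : ℕ) : opH r (u r m) = ((r : ℂ) - 1 - 2 * m) • u r m :=
  onBasis_smul_u r m _ _ le_refl

theorem opE_pow_u {r m : ℕ} (hm : m < r) (a : ℕ) :
    (opE r ^ a) (u r m) = if a ≤ m then u r (m - a) else 0 := by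
  induction a with
  | zero => simp
  | succ a ih =>
    rw [pow_succ', Module.End.mul_apply, ih]
    rcases lt_trichotomy a m with h | rfl | h
    · obtain ⟨t, rfl⟩ := Nat.exists_eq_add_of_lt h
      rw [if_pos h.le, if_pos (by omega), show a + t + 1 - a = t + 1 by omega,
        opE_u_succ (by omega), show a + t + 1 - (a + 1) = t by omega]
    · rw [if_pos le_rfl, if_neg (by omega), Nat.sub_self, opE_u_zero]
    · rw [if_neg (by omega), if_neg (by omega), map_zero]

theorem opE_pow_u_eq_zero {r m a : ℕ} (h : m < a) : (opE r ^ a) (u r m) = 0 := by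
  rcases lt_or_ge m r with hm | hm
  · rw [opE_pow_u hm, if_neg h.not_ge]
  · rw [u_eq_zero hm, map_zero]

theorem opE_pow_self (r : ℕ) : opE r ^ r = 0 :=
  end_ext_u fun _ hm => opE_pow_u_eq_zero hm

theorem opF_pow_u (r m a : ℕ) [NeZero r] :
    (opF r ^ a) (u r m) = (∏ i ∈ Finset.range a, qInt r (m + i + 1) ^ 2) • u r (m + a) := by
  induction a with
  | zero => simp
  | succ a ih =>
    rw [pow_succ', Module.End.mul_apply, ih, map_smul, opF_u, smul_smul, Finset.prod_range_succ]
    push_cast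
    rfl

theorem opF_pow_u_eq_zero {r m a : ℕ} [NeZero r] (h : r ≤ m + a) : (opF r ^ a) (u r m) = 0 := by
  rw [opF_pow_u, u_eq_zero h, smul_zero]

theorem opF_pow_self (r : ℕ) [NeZero r] : opF r ^ r = 0 :=
  end_ext_u fun m _ => opF_pow_u_eq_zero (Nat.le_add_left r m)

theorem opK_sq_opE_pow_u {r m : ℕ} (hm : m < r) (a : ℕ) :
    (opK r ^ 2) ((opE r ^ a) (u r m)) =
      qHalf r ^ (2 * ((r : ℤ) - 1 - 2 * (m - a))) • (opE r ^ a) (u r m) := by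
  rw [opE_pow_u hm]
  split_ifs with h
  · rw [opK_pow_u]
    congr 2
    push_cast [h]
    ring
  · simp

theorem opKInv_sq_opE_u {r m : ℕ} (hm : m < r) :
    (opKInv r ^ 2) (opE r (u r m)) =
      qHalf r ^ (-2 * ((r : ℤ) - 1 - 2 * (m - 1))) • opE r (u r m) := by
  cases m with
  | zero => simp [opE_u_zero]
  | succ m => rw [opE_u_succ hm, opKInv_sq_u, Nat.cast_succ, add_sub_cancel_right]

theorem opKInv_sq_opF_pow_u (r m a : ℕ) [NeZero r] :
    (opKInv r ^ 2) ((opF r ^ a) (u r m)) =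
      qHalf r ^ (-2 * ((r : ℤ) - 1 - 2 * (m + a))) • (opF r ^ a) (u r m) := by
  rw [opF_pow_u, map_smul, opKInv_sq_u, smul_comm]
  push_cast
  rfl

theorem opE_opF_u {r m : ℕ} [r.AtLeastTwo] (hm : m < r) :
    opE r (opF r (u r m)) = opF r (opE r (u r m)) + qInt r ((r : ℤ) - 1 - 2 * m) • u r m := by
  have hEF : opE r (opF r (u r m)) = qInt r (m + 1) ^ 2 • u r m := by
    rw [opF_u, map_smul]
    rcases (Nat.succ_le_of_lt hm).lt_or_eq with h | rfl
    · rw [opE_u_succ h]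
    · rw [← Nat.cast_succ, qInt_self, zero_pow two_ne_zero, zero_smul, zero_smul]
  have hFE : opF r (opE r (u r m)) = qInt r m ^ 2 • u r m := by
    cases m with
    | zero => simp [opE_u_zero]
    | succ m => rw [opE_u_succ hm, opF_u, Nat.cast_succ]
  rw [hEF, hFE, ← add_smul, ← qInt_sq_sub_qInt_sq, add_sub_cancel]

end Basis

/-! ### Recursive descriptions of the operators on `V_{r-1}^{⊗ n}` -/

section Recursion

variable {n r : ℕ}

theorem hom_ext_cons_u {M : Type*} [AddCommMonoid M] [Module ℂ M]
    {A B : TensorPow (n + 1) r →ₗ[ℂ] M}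
    (h : ∀ m < r, ∀ x, A (cons (u r m) x) = B (cons (u r m) x)) : A = B :=
  hom_ext_cons fun y x => LinearMap.congr_fun
    (end_ext_u (A := A ∘ₗ cons.flip x) (B := B ∘ₗ cons.flip x) fun m hm => h m hm x) y

theorem hom_ext_cons_u_cons_u {M : Type*} [AddCommMonoid M] [Module ℂ M]
    {A B : TensorPow (n + 2) r →ₗ[ℂ] M}
    (h : ∀ m < r, ∀ p < r, ∀ x,
      A (cons (u r m) (cons (u r p) x)) = B (cons (u r m) (cons (u r p) x))) : A = B :=
  hom_ext_cons_u fun m hm x => LinearMap.congr_fun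
    (hom_ext_cons_u (A := A ∘ₗ cons (u r m)) (B := B ∘ₗ cons (u r m)) (h m hm)) x

theorem sumInsert_zero_left (r : ℕ) (a x b : Module.End ℂ (V r)) : sumInsert 0 r a x b = 0 :=
  Finset.sum_of_isEmpty _

theorem sumInsert_cons (a x b : Module.End ℂ (V r)) (y : V r) (v : TensorPow n r) :
    sumInsert (n + 1) r a x b (cons y v) =
      cons (x y) (PiTensorProduct.map (fun _ => b) v) + cons (a y) (sumInsert n r a x b v) := by
  simp only [sumInsert, Fin.sum_univ_succ, LinearMap.add_apply, LinearMap.sum_apply, map_sum,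
    map_cons]
  simp

/-- The diagonal action of `k²` on `V_{r-1}^{⊗ n}`, which enters the coproduct of `E`. -/
noncomputable def tensorKSq (n r : ℕ) : Module.End ℂ (TensorPow n r) :=
  PiTensorProduct.map fun _ => opK r ^ 2

@[simp]
theorem tensorKSq_zero_left (r : ℕ) : tensorKSq 0 r = 1 := by
  rw [← PiTensorProduct.map_one, tensorKSq]
  congr 1
  exact Subsingleton.elim _ _

@[simp]
theorem tensorE_zero_left (r : ℕ) : tensorE 0 r = 0 := sumInsert_zero_left _ _ _ _

@[simp]
theorem tensorF_zero_left (r : ℕ) : tensorF 0 r = 0 := sumInsert_zero_left _ _ _ _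

@[simp]
theorem tensorH_zero_left (r : ℕ) : tensorH 0 r = 0 := sumInsert_zero_left _ _ _ _

theorem tensorKSq_cons (y : V r) (x : TensorPow n r) :
    tensorKSq (n + 1) r (cons y x) = cons ((opK r ^ 2) y) (tensorKSq n r x) := map_cons _ _ _

theorem tensorE_cons (y : V r) (x : TensorPow n r) :
    tensorE (n + 1) r (cons y x) = cons (opE r y) (tensorKSq n r x) + cons y (tensorE n r x) :=
  sumInsert_cons _ _ _ _ _

theorem tensorF_cons (y : V r) (x : TensorPow n r) :
    tensorF (n + 1) r (cons y x) =
      cons (opF r y) x + cons ((opKInv r ^ 2) y) (tensorF n r x) := by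
  have h := sumInsert_cons (opKInv r ^ 2) (opF r) 1 y x
  rwa [PiTensorProduct.map_one] at h

theorem tensorH_cons (y : V r) (x : TensorPow n r) :
    tensorH (n + 1) r (cons y x) = cons (opH r y) x + cons y (tensorH n r x) := by
  have h := sumInsert_cons 1 (opH r) 1 y x
  rwa [PiTensorProduct.map_one] at h

theorem tensorFlip_succ_cons {i : ℕ} (hi : i + 1 < n + 1) (y : V r) (x : TensorPow (n + 1) r) :
    tensorFlip (n := n + 2) r ⟨i + 1, hi⟩ (cons y x) =
      cons y (tensorFlip (n := n + 1) r ⟨i, Nat.lt_of_succ_lt_succ hi⟩ x) := by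
  have hzero : Equiv.swap (leftPos (n := n + 2) ⟨i + 1, hi⟩) (rightPos ⟨i + 1, hi⟩) 0 = 0 :=
    Equiv.swap_apply_of_ne_of_ne (by simp [leftPos, Fin.ext_iff]) (by simp [rightPos, Fin.ext_iff])
  have hsucc := (Fin.succ_injective (n + 1)).swap_apply
    (leftPos (n := n + 1) ⟨i, Nat.lt_of_succ_lt_succ hi⟩) (rightPos ⟨i, Nat.lt_of_succ_lt_succ hi⟩)
  exact reindex_cons hzero hsucc y x

theorem tensorFlip_zero_cons (y z : V r) (x : TensorPow n r) :
    tensorFlip (n := n + 2) r ⟨0, Nat.succ_pos n⟩ (cons y (cons z x)) = cons z (cons y x) :=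
  reindex_swap_cons_cons y z x

theorem twoLegs_succ_cons {i : ℕ} (hi : i + 1 < n + 1) (a b : Module.End ℂ (V r)) (y : V r)
    (x : TensorPow (n + 1) r) :
    twoLegs (n := n + 2) r ⟨i + 1, hi⟩ a b (cons y x) =
      cons y (twoLegs (n := n + 1) r ⟨i, Nat.lt_of_succ_lt_succ hi⟩ a b x) := by
  rw [twoLegs, map_cons]
  simp [leftPos, rightPos, Fin.ext_iff, twoLegs]

theorem twoLegs_zero_cons (a b : Module.End ℂ (V r)) (y z : V r) (x : TensorPow n r) :
    twoLegs (n := n + 2) r ⟨0, Nat.succ_pos n⟩ a b (cons y (cons z x)) =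
      cons (a y) (cons (b z) x) := by
  rw [twoLegs, map_cons, map_cons]
  simp [leftPos, rightPos, Fin.ext_iff]

theorem sigmaOp_succ_cons {i : ℕ} (hi : i + 1 < n + 1) (y : V r) (x : TensorPow (n + 1) r) :
    sigmaOp (n + 2) r ⟨i + 1, hi⟩ (cons y x) =
      cons y (sigmaOp (n + 1) r ⟨i, Nat.lt_of_succ_lt_succ hi⟩ x) := by
  simp only [sigmaOp, tensorR, LinearMap.smul_apply, Module.End.mul_apply, LinearMap.sum_apply,
    twoLegs_succ_cons, tensorFlip_succ_cons, map_sum, map_smul]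

/-- The coefficient of `F^a u_p ⊗ E^a u_m` in `𝖱 (u_m ⊗ u_p)`, obtained from the universal
`R`-matrix by evaluating its Cartan part on weight vectors. -/
noncomputable def braidCoeff (r : ℕ) (m p : ℤ) (a : ℕ) : ℂ :=
  qNum r 1 ^ (2 * a) / qNumFactorial r a *
    qHalf r ^ ((a : ℤ) * (a - 1) - 2 * (r - 1) * (m + p) + 4 * (m - a) * (p + a))

theorem sigmaOp_zero_cons_u_cons_u [NeZero r] (m p : ℕ) (x : TensorPow n r) :
    sigmaOp (n + 2) r ⟨0, Nat.succ_pos n⟩ (cons (u r m) (cons (u r p) x)) =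
      ∑ a ∈ Finset.range r, braidCoeff r m p a •
        cons ((opF r ^ a) (u r p)) (cons ((opE r ^ a) (u r m)) x) := by
  simp only [sigmaOp, LinearMap.smul_apply, Module.End.mul_apply, tensorR, LinearMap.sum_apply,
    twoLegs_zero_cons, opK_pow_u, map_smul, map_sum, tensorFlip_zero_cons, smul_smul,
    ← Finset.sum_smul, Finset.smul_sum]
  refine Finset.sum_congr rfl fun a _ => ?_
  congr 1
  simp_rw [mul_comm (qHalf r ^ (_ * ((r : ℤ) - 1 - 2 * p)))]
  rw [sum_range_sum_range_coeffR, braidCoeff, mul_left_comm, ← zpow_add₀ (qHalf_ne_zero r)]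
  congr 2
  ring

end Recursion

/-! ### The weight decomposition -/

theorem ker_sub_smul_one_eq_span {R M ι : Type*} [CommRing R] [NoZeroDivisors R] [AddCommGroup M]
    [Module R M] (b : Module.Basis ι R M) {T : Module.End R M} {μ : ι → R}
    (hT : ∀ i, T (b i) = μ i • b i) (c : R) :
    LinearMap.ker (T - c • 1) = Submodule.span R (b '' {i | μ i = c}) := by
  have hrepr (x : M) (i : ι) : b.repr (T x) i = μ i * b.repr x i := by
    have : b.coord i ∘ₗ T = μ i • b.coord i := by
      refine b.ext fun j => ?_
      rcases eq_or_ne j i with rfl | hji <;> simp [*]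
    exact LinearMap.congr_fun this x
  ext x
  rw [LinearMap.mem_ker, b.mem_span_image, ← b.forall_coord_eq_zero_iff]
  refine forall_congr' fun i => ?_
  simp only [Module.Basis.coord_apply, LinearMap.sub_apply, LinearMap.smul_apply,
    Module.End.one_apply, map_sub, map_smul, hrepr, smul_eq_mul, ← sub_mul, mul_eq_zero,
    sub_eq_zero, Finset.mem_coe, Finsupp.mem_support_iff, Set.mem_ofPred_eq]
  tauto

/-- The span of the vectors `u_{ε_1} ⊗ ⋯ ⊗ u_{ε_n}` with `ε_1 + ⋯ + ε_n = ℓ`, the paper's first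
description of `V_{n,ℓ}`; the index `ℓ` is an integer so that `E` lowers it unconditionally. -/
def degreeSpace (n r : ℕ) (ℓ : ℤ) : Submodule ℂ (TensorPow n r) :=
  Submodule.span ℂ {v | ∃ ε : Fin n → Fin r, ∑ i, ((ε i : ℕ) : ℤ) = ℓ ∧
    v = PiTensorProduct.tprod ℂ fun i => u r (ε i)}

section DegreeSpace

variable {n r : ℕ} {ℓ : ℤ}

theorem cons_mem_degreeSpace {m : ℕ} (hm : m < r) {x : TensorPow n r}
    (hx : x ∈ degreeSpace n r ℓ) : cons (u r m) x ∈ degreeSpace (n + 1) r (m + ℓ) := by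
  suffices degreeSpace n r ℓ ≤ (degreeSpace (n + 1) r (m + ℓ)).comap (cons (u r m)) from this hx
  refine Submodule.span_le.2 ?_
  rintro _ ⟨ε, hε, rfl⟩
  refine Submodule.subset_span ⟨Fin.cons ⟨m, hm⟩ ε, by simp [Fin.sum_univ_succ, hε], ?_⟩
  rw [cons_tprod]
  congr 1
  ext i : 1
  cases i using Fin.cases <;> simp

theorem degreeSpace_succ_le {S : Submodule ℂ (TensorPow (n + 1) r)}
    (h : ∀ m < r, ∀ x ∈ degreeSpace n r (ℓ - m), cons (u r m) x ∈ S) :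
    degreeSpace (n + 1) r ℓ ≤ S := by
  refine Submodule.span_le.2 ?_
  rintro _ ⟨ε, rfl, rfl⟩
  have hcons : (fun i => u r (ε i)) =
      (Fin.cons (u r (ε 0)) fun i => u r (Fin.tail ε i) : Fin (n + 1) → V r) :=
    funext (Fin.cases rfl fun _ => rfl)
  rw [hcons, ← cons_tprod]
  refine h (ε 0) (ε 0).2 _ (Submodule.subset_span ⟨Fin.tail ε, ?_, rfl⟩)
  simp [Fin.sum_univ_succ, Fin.tail]

theorem degreeSpace_induction {S : ∀ n : ℕ, ℤ → Submodule ℂ (TensorPow n r)}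
    (zero : ∀ x, x ∈ S 0 0)
    (cons : ∀ n ℓ, ∀ m < r, ∀ x ∈ degreeSpace n r ℓ, x ∈ S n ℓ →
      cons (u r m) x ∈ S (n + 1) (m + ℓ)) : degreeSpace n r ℓ ≤ S n ℓ := by
  induction n generalizing ℓ with
  | zero =>
    refine Submodule.span_le.2 ?_
    rintro _ ⟨ε, rfl, rfl⟩
    exact zero _
  | succ n ih =>
    refine degreeSpace_succ_le fun m hm x hx => ?_
    have h := cons n _ m hm x hx (ih hx)
    rwa [add_sub_cancel] at h

theorem hom_ext_degreeSpace {M : Type*} [AddCommMonoid M] [Module ℂ M]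
    {A B : TensorPow n r →ₗ[ℂ] M} (h : ∀ ℓ, ∀ x ∈ degreeSpace n r ℓ, A x = B x) : A = B := by
  induction n with
  | zero =>
    refine PiTensorProduct.ext (MultilinearMap.ext fun g => ?_)
    refine h 0 _ (Submodule.subset_span ⟨Fin.elim0, by simp, ?_⟩)
    congr 1
    exact Subsingleton.elim _ _
  | succ n ih =>
    refine hom_ext_cons_u fun m hm x => ?_
    have : A ∘ₗ cons (u r m) = B ∘ₗ cons (u r m) :=
      ih fun ℓ x hx => h _ _ (cons_mem_degreeSpace hm hx)
    exact LinearMap.congr_fun this x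

theorem tensorKSq_apply {x : TensorPow n r} (hx : x ∈ degreeSpace n r ℓ) :
    tensorKSq n r x = qHalf r ^ (2 * (n * ((r : ℤ) - 1) - 2 * ℓ)) • x := by
  refine degreeSpace_induction (S := fun n ℓ => LinearMap.eqLocus (tensorKSq n r)
    (qHalf r ^ (2 * (n * ((r : ℤ) - 1) - 2 * ℓ)) • 1)) (fun x => by simp)
    (fun n ℓ m _ x _ ih => ?_) hx
  rw [LinearMap.mem_eqLocus, LinearMap.smul_apply, Module.End.one_apply] at ih ⊢
  rw [tensorKSq_cons, ih, opK_pow_u, map_smul, map_smul, LinearMap.smul_apply, smul_smul,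
    ← zpow_add₀ (qHalf_ne_zero r)]
  congr 2
  push_cast
  ring

theorem tensorH_apply {x : TensorPow n r} (hx : x ∈ degreeSpace n r ℓ) :
    tensorH n r x = ((n : ℂ) * ((r : ℂ) - 1) - 2 * ℓ) • x := by
  refine degreeSpace_induction (S := fun n ℓ => LinearMap.eqLocus (tensorH n r)
    (((n : ℂ) * ((r : ℂ) - 1) - 2 * ℓ) • 1)) (fun x => by simp) (fun n ℓ m _ x _ ih => ?_) hx
  rw [LinearMap.mem_eqLocus, LinearMap.smul_apply, Module.End.one_apply] at ih ⊢
  rw [tensorH_cons, ih, opH_u, map_smul, map_smul, LinearMap.smul_apply, ← add_smul]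
  congr 1
  push_cast
  ring

theorem weightSpace_eq_degreeSpace (n r ℓ : ℕ) : weightSpace n r ℓ = degreeSpace n r ℓ := by
  let b := Basis.piTensorProduct fun _ : Fin n => Pi.basisFun ℂ (Fin r)
  have hb (ε : Fin n → Fin r) : b ε = PiTensorProduct.tprod ℂ fun i => u r (ε i) := by
    simp only [b, Basis.piTensorProduct_apply, u_eq_basisFun]
  have hH (ε : Fin n → Fin r) : tensorH n r (b ε) =
      ((n : ℂ) * ((r : ℂ) - 1) - 2 * (∑ i, ((ε i : ℕ) : ℤ) : ℤ)) • b ε :=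
    tensorH_apply (Submodule.subset_span ⟨ε, rfl, hb ε⟩)
  rw [weightSpace, ker_sub_smul_one_eq_span b hH, degreeSpace]
  congr 1
  ext v
  refine exists_congr fun ε => and_congr ?_ (by rw [hb, eq_comm])
  rw [Set.mem_ofPred_eq, sub_right_inj, mul_right_inj' two_ne_zero]
  norm_cast

theorem tensorE_mem {x : TensorPow n r} (hx : x ∈ degreeSpace n r ℓ) :
    tensorE n r x ∈ degreeSpace n r (ℓ - 1) := by
  refine degreeSpace_induction (S := fun n ℓ => (degreeSpace n r (ℓ - 1)).comap (tensorE n r))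
    (fun x => by simp) (fun n ℓ m hm x hx ih => ?_) hx
  rw [Submodule.mem_comap, tensorE_cons, tensorKSq_apply hx, map_smul]
  refine Submodule.add_mem _ (Submodule.smul_mem _ _ ?_) ?_
  · cases m with
    | zero => simp [opE_u_zero]
    | succ m =>
      rw [opE_u_succ hm, Nat.cast_succ, add_right_comm, add_sub_cancel_right]
      exact cons_mem_degreeSpace (Nat.lt_of_succ_lt hm) hx
  · rw [add_sub_assoc]
    exact cons_mem_degreeSpace hm ih

theorem tensorF_mem [NeZero r] {x : TensorPow n r} (hx : x ∈ degreeSpace n r ℓ) :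
    tensorF n r x ∈ degreeSpace n r (ℓ + 1) := by
  refine degreeSpace_induction (S := fun n ℓ => (degreeSpace n r (ℓ + 1)).comap (tensorF n r))
    (fun x => by simp) (fun n ℓ m hm x hx ih => ?_) hx
  rw [Submodule.mem_comap, tensorF_cons, opF_u, opKInv_sq_u, map_smul, map_smul]
  refine Submodule.add_mem _ (Submodule.smul_mem _ _ ?_) (Submodule.smul_mem _ _ ?_)
  · rcases lt_or_ge (m + 1) r with h | h
    · rw [add_right_comm, ← Nat.cast_succ]
      exact cons_mem_degreeSpace h hx
    · simp [u_eq_zero h]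
  · rw [add_assoc]
    exact cons_mem_degreeSpace hm ih

theorem tensorE_pow_mem {x : TensorPow n r} (hx : x ∈ degreeSpace n r ℓ) (a : ℕ) :
    (tensorE n r ^ a) x ∈ degreeSpace n r (ℓ - a) := by
  induction a with
  | zero => simpa using hx
  | succ a ih =>
    rw [pow_succ', Module.End.mul_apply, Nat.cast_succ, ← sub_sub]
    exact tensorE_mem ih

/-! ### Commutation relations -/

/-- The relation `E^{a+1} F - F E^{a+1} = [a+1] [H+a] E^a` of quantum `sl₂`, on a weight vector. -/
theorem pow_succ_apply_of_commutator_eq_qInt {r : ℕ} [r.AtLeastTwo] {M : Type*} [AddCommGroup M]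
    [Module ℂ M] {E F : Module.End ℂ M} {x : M} {y : ℤ}
    (h : ∀ b : ℕ, E (F ((E ^ b) x)) = F (E ((E ^ b) x)) + qInt r (y + 2 * b) • (E ^ b) x) (a : ℕ) :
    (E ^ (a + 1)) (F x) =
      F ((E ^ (a + 1)) x) + (qInt r (a + 1) * qInt r (y + a)) • (E ^ a) x := by
  induction a with
  | zero => simpa using h 0
  | succ a ih =>
    have hcoeff := qInt_mul_qInt_add_qInt (r := r) (a + 1) y
    rw [← add_assoc, add_sub_cancel_right] at hcoeff
    rw [pow_succ', Module.End.mul_apply, ih, map_add, map_smul, h, Module.End.mul_apply,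
      ← Module.End.mul_apply _ (E ^ a), ← pow_succ' _ a]
    push_cast
    rw [← add_assoc, ← hcoeff]
    module

theorem qInt_add (r : ℕ) (x y : ℤ) :
    qInt r (x + y) = qHalf r ^ (2 * x) * qInt r y + qHalf r ^ (-(2 * y)) * qInt r x := by
  simp only [qInt, mul_div_assoc', ← add_div, qNum_eq, mul_sub, ← zpow_add₀ (qHalf_ne_zero r)]
  ring_nf

theorem tensorE_tensorF [r.AtLeastTwo] {x : TensorPow n r} (hx : x ∈ degreeSpace n r ℓ) :
    tensorE n r (tensorF n r x) =
      tensorF n r (tensorE n r x) + qInt r (n * ((r : ℤ) - 1) - 2 * ℓ) • x := by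
  refine degreeSpace_induction (S := fun n ℓ => LinearMap.eqLocus (tensorE n r * tensorF n r)
    (tensorF n r * tensorE n r + qInt r (n * ((r : ℤ) - 1) - 2 * ℓ) • 1)) (fun x => by simp)
    (fun n ℓ m hm x hx ih => ?_) hx
  simp only [LinearMap.mem_eqLocus, Module.End.mul_apply, LinearMap.add_apply,
    LinearMap.smul_apply, Module.End.one_apply] at ih ⊢
  have hexp : -2 * ((r : ℤ) - 1 - 2 * m) + 2 * (n * ((r : ℤ) - 1) - 2 * (ℓ + 1)) =
    2 * (n * ((r : ℤ) - 1) - 2 * ℓ) + -2 * ((r : ℤ) - 1 - 2 * (m - 1)) := by ring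
  have hweight : ((n + 1 : ℕ) * ((r : ℤ) - 1) - 2 * (m + ℓ)) =
      n * ((r : ℤ) - 1) - 2 * ℓ + ((r : ℤ) - 1 - 2 * m) := by
    push_cast
    ring
  simp only [tensorF_cons, tensorE_cons, map_add, map_smul, ih, opKInv_sq_opE_u hm,
    tensorKSq_apply hx, tensorKSq_apply (tensorF_mem hx), opE_opF_u hm, opKInv_sq_u, smul_add,
    smul_smul, LinearMap.add_apply, LinearMap.smul_apply, ← zpow_add₀ (qHalf_ne_zero r)]
  rw [hexp, hweight, qInt_add, ← neg_mul]
  module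

theorem tensorE_pow_tensorF [r.AtLeastTwo] {x : TensorPow n r} (hx : x ∈ degreeSpace n r ℓ)
    (a : ℕ) : (tensorE n r ^ (a + 1)) (tensorF n r x) =
      tensorF n r ((tensorE n r ^ (a + 1)) x) +
        (qInt r (a + 1) * qInt r (n * ((r : ℤ) - 1) - 2 * ℓ + a)) • (tensorE n r ^ a) x := by
  refine pow_succ_apply_of_commutator_eq_qInt (fun b => ?_) a
  rw [tensorE_tensorF (tensorE_pow_mem hx b), mul_sub 2, ← sub_add]

end DegreeSpace

/-! ### The `q`-binomial formula -/

/-- The Gaussian binomial coefficient `(a+b choose a)_Q`, by its `Q`-Pascal recursion. -/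
def gaussBinom {R : Type*} [Semiring R] (Q : R) : ℕ → ℕ → R
  | 0, _ => 1
  | _ + 1, 0 => 1
  | a + 1, b + 1 => Q ^ (b + 1) * gaussBinom Q a (b + 1) + gaussBinom Q (a + 1) b

section GaussBinom

variable {R : Type*} [Semiring R] (Q : R)

@[simp]
theorem gaussBinom_zero_left (b : ℕ) : gaussBinom Q 0 b = 1 := by rw [gaussBinom]

@[simp]
theorem gaussBinom_zero_right (a : ℕ) : gaussBinom Q a 0 = 1 := by
  cases a <;> rw [gaussBinom]

theorem gaussBinom_succ_succ (a b : ℕ) : gaussBinom Q (a + 1) (b + 1) =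
    Q ^ (b + 1) * gaussBinom Q a (b + 1) + gaussBinom Q (a + 1) b := by
  rw [gaussBinom]

end GaussBinom

/-- The `Q`-binomial formula for a sum `T` of two operators that commute up to `Q`, with `v a b`
standing for the ordered product of `a` copies of the first and `b` of the second. -/
theorem pow_apply_eq_sum_gaussBinom {R M : Type*} [CommSemiring R] [AddCommMonoid M] [Module R M]
    {Q : R} {T : Module.End R M} {v : ℕ → ℕ → M}
    (hv : ∀ a b, T (v a b) = Q ^ b • v (a + 1) b + v a (b + 1)) (c : ℕ) :
    (T ^ c) (v 0 0) =
      ∑ p ∈ Finset.HasAntidiagonal.antidiagonal c, gaussBinom Q p.1 p.2 • v p.1 p.2 := by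
  induction c with
  | zero => simp
  | succ c ih =>
    rw [pow_succ', Module.End.mul_apply, ih, map_sum]
    simp only [map_smul, hv, smul_add, Finset.sum_add_distrib, smul_smul]
    cases c with
    | zero =>
      simp [Finset.Nat.antidiagonal_succ, add_comm]
    | succ c =>
      rw [Finset.Nat.sum_antidiagonal_succ' (n := c), Finset.Nat.sum_antidiagonal_succ (n := c),
        Finset.Nat.sum_antidiagonal_succ' (n := c + 1), Finset.Nat.sum_antidiagonal_succ (n := c)]
      simp only [gaussBinom_succ_succ, gaussBinom_zero_left, gaussBinom_zero_right, add_smul,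
        Finset.sum_add_distrib, mul_comm (gaussBinom Q _ _), pow_zero, mul_one, one_smul]
      abel

section QNumFactorial

variable {r a b : ℕ}

theorem q_sq_pow (r b : ℕ) : (q r ^ 2) ^ b = qHalf r ^ (4 * (b : ℤ)) := by
  rw [q_eq_qHalf_sq, ← pow_mul, ← pow_mul, ← zpow_natCast]
  push_cast
  ring_nf

theorem gaussBinom_mul_qNumFactorial (r a b : ℕ) :
    gaussBinom (q r ^ 2) a b * (qNumFactorial r a * qNumFactorial r b) =
      qHalf r ^ (2 * (a : ℤ) * b) * qNumFactorial r (a + b) := by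
  induction a generalizing b with
  | zero => simp
  | succ a iha =>
    induction b with
    | zero => simp
    | succ b ihb =>
      have hPascal : qHalf r ^ (4 * ((b + 1 : ℕ) : ℤ)) * qHalf r ^ (2 * (a : ℤ) * (b + 1 : ℕ)) *
          qNum r (a + 1) + qHalf r ^ (2 * ((a + 1 : ℕ) : ℤ) * b) * qNum r (b + 1) =
          qHalf r ^ (2 * ((a + 1 : ℕ) : ℤ) * (b + 1 : ℕ)) * qNum r ((a + b + 1 : ℕ) + 1) := by
        simp only [qNum_eq, mul_sub, ← zpow_add₀ (qHalf_ne_zero r)]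
        push_cast
        ring_nf
      have iha := iha (b + 1)
      rw [qNumFactorial_succ r b, ← add_assoc] at iha
      rw [qNumFactorial_succ r a, Nat.add_right_comm a 1 b] at ihb
      rw [gaussBinom_succ_succ, q_sq_pow, ← add_assoc, Nat.add_right_comm a 1 b,
        qNumFactorial_succ r (a + b + 1), qNumFactorial_succ r a, qNumFactorial_succ r b]
      linear_combination (qHalf r ^ (4 * ((b + 1 : ℕ) : ℤ)) * qNum r (a + 1)) * iha +
        qNum r (b + 1) * ihb + qNumFactorial r (a + b + 1) * hPascal

theorem gaussBinom_q_sq [NeZero r] (h : a + b < r) :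
    gaussBinom (q r ^ 2) a b = qHalf r ^ (2 * (a : ℤ) * b) * qNumFactorial r (a + b) /
      (qNumFactorial r a * qNumFactorial r b) := by
  rw [eq_div_iff (mul_ne_zero (qNumFactorial_ne_zero (by omega))
    (qNumFactorial_ne_zero (by omega))), gaussBinom_mul_qNumFactorial]

theorem gaussBinom_q_sq_eq_zero [NeZero r] (h : a + b = r) (ha : a ≠ 0) (hb : b ≠ 0) :
    gaussBinom (q r ^ 2) a b = 0 := by
  have hmul := gaussBinom_mul_qNumFactorial r a b
  rw [h, qNumFactorial_self, mul_zero] at hmul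
  exact (mul_eq_zero.1 hmul).resolve_right
    (mul_ne_zero (qNumFactorial_ne_zero (by omega)) (qNumFactorial_ne_zero (by omega)))

theorem sum_gaussBinom_q_sq_smul_self [NeZero r] {M : Type*} [AddCommMonoid M] [Module ℂ M]
    (v : ℕ → ℕ → M) : ∑ p ∈ Finset.HasAntidiagonal.antidiagonal r,
      gaussBinom (q r ^ 2) p.1 p.2 • v p.1 p.2 = v 0 r + v r 0 := by
  have hr : r ≠ 0 := NeZero.ne r
  rw [← Finset.sum_subset (s₁ := {(0, r), (r, 0)}) (by simp [Finset.insert_subset_iff])]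
  · rw [Finset.sum_pair (by simp [hr.symm])]
    simp
  · rintro ⟨a, b⟩ hp hab
    rw [Finset.HasAntidiagonal.mem_antidiagonal] at hp
    simp only [Finset.mem_insert, Finset.mem_singleton, Prod.mk.injEq, not_or, not_and] at hp hab
    rw [gaussBinom_q_sq_eq_zero hp (by omega) (by omega), zero_smul]

end QNumFactorial

/-! ### Powers of `E` and `F` -/

section Powers

variable {n r : ℕ}

theorem tensorE_pow_cons {ℓ : ℤ} (y : V r) {x : TensorPow n r} (hx : x ∈ degreeSpace n r ℓ)
    (c : ℕ) : (tensorE (n + 1) r ^ c) (cons y x) = ∑ p ∈ Finset.HasAntidiagonal.antidiagonal c,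
      gaussBinom (q r ^ 2) p.1 p.2 • qHalf r ^ (2 * (p.1 : ℤ) * (n * ((r : ℤ) - 1) - 2 * ℓ)) •
        cons ((opE r ^ p.1) y) ((tensorE n r ^ p.2) x) := by
  have h := pow_apply_eq_sum_gaussBinom (T := tensorE (n + 1) r) (Q := q r ^ 2)
    (v := fun a b => qHalf r ^ (2 * (a : ℤ) * (n * ((r : ℤ) - 1) - 2 * ℓ)) •
      cons ((opE r ^ a) y) ((tensorE n r ^ b) x)) (fun a b => ?_) c
  · simpa using h
  · rw [map_smul, tensorE_cons, tensorKSq_apply (tensorE_pow_mem hx b), map_smul, smul_add,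
      smul_smul, smul_smul, q_sq_pow, ← zpow_add₀ (qHalf_ne_zero r),
      ← zpow_add₀ (qHalf_ne_zero r), pow_succ', pow_succ', Module.End.mul_apply,
      Module.End.mul_apply]
    congr 3
    push_cast
    ring

theorem tensorF_pow_cons [NeZero r] (m : ℕ) (x : TensorPow n r) (c : ℕ) :
    (tensorF (n + 1) r ^ c) (cons (u r m) x) = ∑ p ∈ Finset.HasAntidiagonal.antidiagonal c,
      gaussBinom (q r ^ 2) p.1 p.2 • qHalf r ^ (-2 * (p.1 : ℤ) * ((r : ℤ) - 1 - 2 * m)) •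
        cons ((opF r ^ p.2) (u r m)) ((tensorF n r ^ p.1) x) := by
  have h := pow_apply_eq_sum_gaussBinom (T := tensorF (n + 1) r) (Q := q r ^ 2)
    (v := fun a b => qHalf r ^ (-2 * (a : ℤ) * ((r : ℤ) - 1 - 2 * m)) •
      cons ((opF r ^ b) (u r m)) ((tensorF n r ^ a) x)) (fun a b => ?_) c
  · simpa using h
  · rw [map_smul, tensorF_cons, opKInv_sq_opF_pow_u, map_smul, LinearMap.smul_apply, smul_add,
      smul_smul, smul_smul, q_sq_pow, ← zpow_add₀ (qHalf_ne_zero r),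
      ← zpow_add₀ (qHalf_ne_zero r), pow_succ', pow_succ', Module.End.mul_apply,
      Module.End.mul_apply, add_comm (_ • cons (opF r _) _)]
    congr 3
    push_cast
    ring

theorem tensorE_pow_self (n r : ℕ) [NeZero r] : tensorE n r ^ r = 0 := by
  induction n with
  | zero => rw [tensorE_zero_left, zero_pow (NeZero.ne r)]
  | succ n ih =>
    refine hom_ext_cons_u fun m _ x => ?_
    have : (tensorE (n + 1) r ^ r) ∘ₗ cons (u r m) = 0 := hom_ext_degreeSpace fun ℓ x hx => by
      rw [LinearMap.comp_apply, tensorE_pow_cons _ hx, sum_gaussBinom_q_sq_smul_self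
        (fun a b => qHalf r ^ (2 * (a : ℤ) * (n * ((r : ℤ) - 1) - 2 * ℓ)) •
          cons ((opE r ^ a) (u r m)) ((tensorE n r ^ b) x)), ih, opE_pow_self]
      simp
    exact LinearMap.congr_fun this x

theorem tensorF_pow_self (n r : ℕ) [NeZero r] : tensorF n r ^ r = 0 := by
  induction n with
  | zero => rw [tensorF_zero_left, zero_pow (NeZero.ne r)]
  | succ n ih =>
    refine hom_ext_cons_u fun m _ x => ?_
    rw [tensorF_pow_cons, sum_gaussBinom_q_sq_smul_self
      (fun a b => qHalf r ^ (-2 * (a : ℤ) * ((r : ℤ) - 1 - 2 * m)) •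
        cons ((opF r ^ b) (u r m)) ((tensorF n r ^ a) x)), ih, opF_pow_self]
    simp

theorem opE_pow_opF_u [r.AtLeastTwo] {m : ℕ} (hm : m < r) (a : ℕ) :
    (opE r ^ (a + 1)) (opF r (u r m)) = opF r ((opE r ^ (a + 1)) (u r m)) +
      (qInt r (a + 1) * qInt r ((r : ℤ) - 1 - 2 * m + a)) • (opE r ^ a) (u r m) := by
  refine pow_succ_apply_of_commutator_eq_qInt (fun b => ?_) a
  rw [opE_pow_u hm]
  split_ifs with h
  · rw [opE_opF_u (by omega)]
    push_cast [h]
    ring_nf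
  · simp

theorem opE_opF_pow_u (r m a : ℕ) [r.AtLeastTwo] :
    opE r ((opF r ^ (a + 1)) (u r m)) = (opF r ^ (a + 1)) (opE r (u r m)) +
      (qInt r (a + 1) * qInt r ((r : ℤ) - 1 - 2 * m - a)) • (opF r ^ a) (u r m) := by
  have h := pow_succ_apply_of_commutator_eq_qInt (r := r) (E := opF r) (F := opE r) (x := u r m)
    (y := -((r : ℤ) - 1 - 2 * m)) (fun b => ?_) a
  · rw [h, neg_add_eq_sub, ← neg_sub, qInt_neg]
    module
  · rcases lt_or_ge (m + b) r with hmb | hmb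
    · rw [opF_pow_u, map_smul, map_smul, map_smul, map_smul, opE_opF_u hmb, Nat.cast_add, ← neg_neg
        (-((r : ℤ) - 1 - 2 * m) + 2 * b), qInt_neg]
      ring_nf
      module
    · simp [opF_pow_u_eq_zero hmb]

end Powers

/-! ### Equivariance of the braiding on two factors -/

section BraidCoeff

variable {r : ℕ} {M : Type*} [AddCommGroup M] [Module ℂ M]

theorem braidCoeff_succ [NeZero r] {a : ℕ} (ha : a + 1 < r) (m p y : ℤ) :
    braidCoeff r m p (a + 1) * (qInt r (a + 1) * qInt r y) =
      qNum r 1 ^ (2 * a) / qNumFactorial r a * qHalf r ^ (((a : ℤ) + 1) * a -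
        2 * (r - 1) * (m + p) + 4 * (m - a - 1) * (p + a + 1)) * qNum r y := by
  have h1 : qNum r 1 ≠ 0 := qNum_ne_zero (by omega) (by omega)
  have h2 : qNum r (a + 1) ≠ 0 := qNum_ne_zero (by omega) (by omega)
  have h3 : qNumFactorial r a ≠ 0 := qNumFactorial_ne_zero (by omega)
  have hexp : ((a + 1 : ℕ) : ℤ) * ((a + 1 : ℕ) - 1) - 2 * (r - 1) * (m + p) +
      4 * (m - (a + 1 : ℕ)) * (p + (a + 1 : ℕ)) = ((a : ℤ) + 1) * a -
        2 * (r - 1) * (m + p) + 4 * (m - a - 1) * (p + a + 1) := by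
    push_cast
    ring
  rw [braidCoeff, qNumFactorial_succ, qInt, qInt, hexp]
  field_simp
  ring

theorem braidCoeff_opE_rec [NeZero r] {a : ℕ} (ha : a + 1 < r) (m p : ℤ) :
    qHalf r ^ (2 * ((r : ℤ) - 1 - 2 * p)) * braidCoeff r (m - 1) p a =
      braidCoeff r m p (a + 1) * (qInt r (a + 1) * qInt r ((r : ℤ) - 1 - 2 * p - a)) *
        qHalf r ^ (2 * ((r : ℤ) - 1 - 2 * (m - (a + 1 : ℕ)))) + braidCoeff r m p a := by
  rw [braidCoeff_succ ha, braidCoeff, braidCoeff, mul_left_comm, mul_assoc (_ / _ * _),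
    mul_assoc (_ / _), ← mul_add, qNum_eq r (_ - _), sub_mul]
  simp only [mul_sub, ← zpow_add₀ (qHalf_ne_zero r)]
  push_cast
  ring_nf

theorem braidCoeff_opF_rec [NeZero r] {a : ℕ} (ha : a + 1 < r) (m p : ℤ) :
    braidCoeff r (m + 1) p (a + 1) * (qInt r (a + 1) * qInt r ((r : ℤ) - 1 - 2 * m + a)) +
      qHalf r ^ (-2 * ((r : ℤ) - 1 - 2 * m)) * braidCoeff r m (p + 1) a = braidCoeff r m p a := by
  rw [braidCoeff_succ ha, braidCoeff, braidCoeff, mul_left_comm (qHalf r ^ _),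
    mul_assoc (_ / _), ← mul_add, qNum_eq r (_ + _), mul_sub]
  simp only [← zpow_add₀ (qHalf_ne_zero r)]
  ring_nf

theorem braidCoeff_sub_one_right (r : ℕ) (m p : ℤ) (a : ℕ) :
    braidCoeff r m (p - 1) a =
      braidCoeff r m p a * qHalf r ^ (2 * ((r : ℤ) - 1 - 2 * (m - a))) := by
  rw [braidCoeff, braidCoeff, mul_assoc (_ / _), ← zpow_add₀ (qHalf_ne_zero r)]
  ring_nf

theorem braidCoeff_add_one_left (r : ℕ) (m p : ℤ) (a : ℕ) :
    braidCoeff r (m + 1) p a =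
      braidCoeff r m p a * qHalf r ^ (-2 * ((r : ℤ) - 1 - 2 * (p + a))) := by
  rw [braidCoeff, braidCoeff, mul_assoc (_ / _), ← zpow_add₀ (qHalf_ne_zero r)]
  ring_nf

theorem sum_braidCoeff_opE [r.AtLeastTwo] {m : ℕ} (p : ℕ) (hm : m < r)
    (B : V r →ₗ[ℂ] V r →ₗ[ℂ] M) :
    qHalf r ^ (2 * ((r : ℤ) - 1 - 2 * p)) • ∑ a ∈ Finset.range r, braidCoeff r (m - 1) p a •
        B ((opF r ^ a) (u r p)) ((opE r ^ (a + 1)) (u r m)) +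
      ∑ a ∈ Finset.range r, braidCoeff r m (p - 1) a •
        B ((opF r ^ a) (opE r (u r p))) ((opE r ^ a) (u r m)) =
    ∑ a ∈ Finset.range r, braidCoeff r m p a • (
      B (opE r ((opF r ^ a) (u r p))) ((opK r ^ 2) ((opE r ^ a) (u r m))) +
      B ((opF r ^ a) (u r p)) ((opE r ^ (a + 1)) (u r m))) := by
  -- The part of `E F^a u_p` coming from `[E, F^a]`, which is shifted from `a` to `a + 1`.
  let f : ℕ → M := fun a => braidCoeff r m (p - 1) a •
    B (opE r ((opF r ^ a) (u r p)) - (opF r ^ a) (opE r (u r p))) ((opE r ^ a) (u r m))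
  have hshift : ∑ a ∈ Finset.range r, f (a + 1) = ∑ a ∈ Finset.range r, f a := by
    have hzero : f 0 = 0 := by simp [f]
    have hr : f r = 0 := by simp [f, opE_pow_self]
    simpa [hzero, hr] using (Finset.sum_range_succ' f r).symm.trans (Finset.sum_range_succ f r)
  have hterm : ∀ a ∈ Finset.range r, (qHalf r ^ (2 * ((r : ℤ) - 1 - 2 * p)) *
      braidCoeff r (m - 1) p a) • B ((opF r ^ a) (u r p)) ((opE r ^ (a + 1)) (u r m)) =
      f (a + 1) + braidCoeff r m p a • B ((opF r ^ a) (u r p)) ((opE r ^ (a + 1)) (u r m)) := by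
    intro a ha
    rcases (Nat.succ_le_of_lt (Finset.mem_range.1 ha)).lt_or_eq with ha | ha
    · simp only [f, braidCoeff_opE_rec ha, opE_opF_pow_u, add_sub_cancel_left, map_smul,
        LinearMap.smul_apply, smul_smul, add_smul, braidCoeff_sub_one_right, mul_right_comm]
    · simp [f, show a + 1 = r from ha, opE_pow_self]
  simp only [Finset.smul_sum, smul_smul]
  rw [Finset.sum_congr rfl hterm, Finset.sum_add_distrib, hshift, add_right_comm,
    ← Finset.sum_add_distrib, ← Finset.sum_add_distrib]
  refine Finset.sum_congr rfl fun a _ => ?_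
  simp only [f, opK_sq_opE_pow_u hm, map_smul, map_sub, LinearMap.sub_apply, smul_sub, smul_add,
    sub_add_cancel, smul_smul, braidCoeff_sub_one_right]

theorem sum_braidCoeff_opF [r.AtLeastTwo] {m : ℕ} (p : ℕ) (hm : m < r)
    (B : V r →ₗ[ℂ] V r →ₗ[ℂ] M) :
    ∑ a ∈ Finset.range r, braidCoeff r (m + 1) p a •
        B ((opF r ^ a) (u r p)) ((opE r ^ a) (opF r (u r m))) +
      qHalf r ^ (-2 * ((r : ℤ) - 1 - 2 * m)) • ∑ a ∈ Finset.range r, braidCoeff r m (p + 1) a •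
        B ((opF r ^ (a + 1)) (u r p)) ((opE r ^ a) (u r m)) =
    ∑ a ∈ Finset.range r, braidCoeff r m p a • (
      B ((opF r ^ (a + 1)) (u r p)) ((opE r ^ a) (u r m)) +
      B ((opKInv r ^ 2) ((opF r ^ a) (u r p))) (opF r ((opE r ^ a) (u r m)))) := by
  -- The part of `E^a F u_m` coming from `[E^a, F]`, which is shifted from `a` to `a + 1`.
  let f : ℕ → M := fun a => braidCoeff r (m + 1) p a •
    B ((opF r ^ a) (u r p)) ((opE r ^ a) (opF r (u r m)) - opF r ((opE r ^ a) (u r m)))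
  have hshift : ∑ a ∈ Finset.range r, f a = ∑ a ∈ Finset.range r, f (a + 1) := by
    have hzero : f 0 = 0 := by simp [f]
    have hr : f r = 0 := by simp [f, opF_pow_self]
    simpa [hzero, hr] using (Finset.sum_range_succ f r).symm.trans (Finset.sum_range_succ' f r)
  have hterm : ∀ a ∈ Finset.range r, f (a + 1) + (qHalf r ^ (-2 * ((r : ℤ) - 1 - 2 * m)) *
      braidCoeff r m (p + 1) a) • B ((opF r ^ (a + 1)) (u r p)) ((opE r ^ a) (u r m)) =
      braidCoeff r m p a • B ((opF r ^ (a + 1)) (u r p)) ((opE r ^ a) (u r m)) := by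
    intro a ha
    rcases (Nat.succ_le_of_lt (Finset.mem_range.1 ha)).lt_or_eq with ha | ha
    · simp only [f, opE_pow_opF_u hm, add_sub_cancel_left, map_smul, smul_smul, ← add_smul,
        braidCoeff_opF_rec ha]
    · simp [f, show a + 1 = r from ha, opF_pow_self]
  simp only [Finset.smul_sum, smul_smul, smul_add]
  rw [Finset.sum_add_distrib, ← Finset.sum_congr rfl hterm, Finset.sum_add_distrib, ← hshift,
    add_right_comm]
  congr 1
  rw [← Finset.sum_add_distrib]
  refine Finset.sum_congr rfl fun a _ => ?_
  simp only [f, opKInv_sq_opF_pow_u, map_smul, LinearMap.smul_apply, map_sub, smul_sub, smul_smul,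
    braidCoeff_add_one_left]
  abel

end BraidCoeff

/-! ### The braid operators -/

section SigmaOp

variable {n r : ℕ}

theorem sigmaOp_zero_cons_opE [NeZero r] {m : ℕ} (hm : m < r) (p : ℕ) (x : TensorPow n r) :
    sigmaOp (n + 2) r ⟨0, Nat.succ_pos n⟩ (cons (opE r (u r m)) (cons (u r p) x)) =
      ∑ a ∈ Finset.range r, braidCoeff r (m - 1) p a •
        cons ((opF r ^ a) (u r p)) (cons ((opE r ^ (a + 1)) (u r m)) x) := by
  simp only [pow_succ, Module.End.mul_apply]
  cases m with
  | zero => simp [opE_u_zero]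
  | succ m =>
    rw [opE_u_succ hm, sigmaOp_zero_cons_u_cons_u, Nat.cast_succ, add_sub_cancel_right]

theorem sigmaOp_zero_cons_cons_opE [NeZero r] {p : ℕ} (m : ℕ) (hp : p < r) (x : TensorPow n r) :
    sigmaOp (n + 2) r ⟨0, Nat.succ_pos n⟩ (cons (u r m) (cons (opE r (u r p)) x)) =
      ∑ a ∈ Finset.range r, braidCoeff r m (p - 1) a •
        cons ((opF r ^ a) (opE r (u r p))) (cons ((opE r ^ a) (u r m)) x) := by
  cases p with
  | zero => simp [opE_u_zero]
  | succ p =>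
    rw [opE_u_succ hp, sigmaOp_zero_cons_u_cons_u, Nat.cast_succ, add_sub_cancel_right]

theorem sigmaOp_zero_cons_opF [NeZero r] (m p : ℕ) (x : TensorPow n r) :
    sigmaOp (n + 2) r ⟨0, Nat.succ_pos n⟩ (cons (opF r (u r m)) (cons (u r p) x)) =
      ∑ a ∈ Finset.range r, braidCoeff r (m + 1) p a •
        cons ((opF r ^ a) (u r p)) (cons ((opE r ^ a) (opF r (u r m))) x) := by
  simp only [opF_u, map_smul, LinearMap.smul_apply, sigmaOp_zero_cons_u_cons_u, Nat.cast_succ,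
    Finset.smul_sum, smul_comm (qInt r (m + 1) ^ 2)]

theorem sigmaOp_zero_cons_cons_opF [NeZero r] (m p : ℕ) (x : TensorPow n r) :
    sigmaOp (n + 2) r ⟨0, Nat.succ_pos n⟩ (cons (u r m) (cons (opF r (u r p)) x)) =
      ∑ a ∈ Finset.range r, braidCoeff r m (p + 1) a •
        cons ((opF r ^ (a + 1)) (u r p)) (cons ((opE r ^ a) (u r m)) x) := by
  simp only [pow_succ (opF r), Module.End.mul_apply, opF_u, map_smul, LinearMap.smul_apply,
    sigmaOp_zero_cons_u_cons_u, Nat.cast_succ, Finset.smul_sum, smul_comm (qInt r (p + 1) ^ 2)]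

theorem sigmaOp_zero_cons_u_zero [NeZero r] (p : ℕ) (x : TensorPow n r) :
    sigmaOp (n + 2) r ⟨0, Nat.succ_pos n⟩ (cons (u r 0) (cons (u r p) x)) =
      qHalf r ^ (-2 * ((r : ℤ) - 1) * p) • cons (u r p) (cons (u r 0) x) := by
  rw [sigmaOp_zero_cons_u_cons_u, Finset.sum_eq_single_of_mem 0 (by simp [NeZero.pos])]
  · simp [braidCoeff, qNumFactorial_zero]
  · intro a _ ha
    simp [opE_pow_u_eq_zero (Nat.pos_of_ne_zero ha)]

theorem crossing_induction {P : ∀ n, Fin (n - 1) → Prop}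
    (zero : ∀ n, P (n + 2) ⟨0, Nat.succ_pos n⟩)
    (succ : ∀ n i (hi : i + 1 < n + 1), P (n + 1) ⟨i, Nat.lt_of_succ_lt_succ hi⟩ →
      P (n + 2) ⟨i + 1, hi⟩) (n : ℕ) (i : Fin (n - 1)) : P n i := by
  obtain ⟨i, hi⟩ := i
  obtain ⟨n, rfl⟩ : ∃ k, n = k + 2 := ⟨n - 2, by omega⟩
  induction i generalizing n with
  | zero => exact zero n
  | succ i ih =>
    obtain ⟨n, rfl⟩ : ∃ k, n = k + 1 := ⟨n - 1, by omega⟩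
    exact succ (n + 1) i hi (ih n (Nat.lt_of_succ_lt_succ hi))

theorem sigmaOp_mem [NeZero r] (i : Fin (n - 1)) {ℓ : ℤ} {x : TensorPow n r}
    (hx : x ∈ degreeSpace n r ℓ) : sigmaOp n r i x ∈ degreeSpace n r ℓ := by
  suffices ∀ ℓ, degreeSpace n r ℓ ≤ (degreeSpace n r ℓ).comap (sigmaOp n r i) from this ℓ hx
  refine crossing_induction (P := fun n i => ∀ ℓ, degreeSpace n r ℓ ≤
    (degreeSpace n r ℓ).comap (sigmaOp n r i)) (fun n ℓ => ?_) (fun n i hi ih ℓ => ?_) n i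
  · refine degreeSpace_succ_le fun m hm x hx => degreeSpace_succ_le
      (S := ((degreeSpace (n + 2) r ℓ).comap (sigmaOp (n + 2) r _)).comap (cons (u r m)))
      (fun p _ x hx => ?_) hx
    rw [Submodule.mem_comap, Submodule.mem_comap, sigmaOp_zero_cons_u_cons_u]
    refine Submodule.sum_mem _ fun a _ => Submodule.smul_mem _ _ ?_
    rcases lt_or_ge m a with hma | hma
    · simp [opE_pow_u_eq_zero hma]
    rcases lt_or_ge (p + a) r with hpa | hpa
    · rw [opE_pow_u hm, if_pos hma, opF_pow_u, map_smul]
      have h := cons_mem_degreeSpace hpa (cons_mem_degreeSpace (by omega : m - a < r) hx)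
      rw [show ((p + a : ℕ) : ℤ) + ((m - a : ℕ) + (ℓ - m - p)) = ℓ by push_cast [hma]; ring] at h
      exact Submodule.smul_mem _ _ h
    · simp [opF_pow_u_eq_zero hpa]
  · refine degreeSpace_succ_le fun m hm x hx => ?_
    rw [Submodule.mem_comap, sigmaOp_succ_cons, ← add_sub_cancel (m : ℤ) ℓ]
    exact cons_mem_degreeSpace hm (ih _ hx)

theorem commute_sigmaOp_tensorKSq [NeZero r] (i : Fin (n - 1)) :
    Commute (sigmaOp n r i) (tensorKSq n r) :=
  hom_ext_degreeSpace fun ℓ x hx => by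
    rw [Module.End.mul_apply, Module.End.mul_apply, tensorKSq_apply hx,
      tensorKSq_apply (sigmaOp_mem i hx), map_smul]

theorem commute_sigmaOp_tensorH [NeZero r] (i : Fin (n - 1)) :
    Commute (sigmaOp n r i) (tensorH n r) :=
  hom_ext_degreeSpace fun ℓ x hx => by
    rw [Module.End.mul_apply, Module.End.mul_apply, tensorH_apply hx,
      tensorH_apply (sigmaOp_mem i hx), map_smul]

theorem commute_sigmaOp_tensorE [r.AtLeastTwo] (i : Fin (n - 1)) :
    Commute (sigmaOp n r i) (tensorE n r) := by
  refine crossing_induction (P := fun n i => Commute (sigmaOp n r i) (tensorE n r))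
    (fun n => ?_) (fun n i hi ih => ?_) n i
  · refine hom_ext_cons_u_cons_u fun m hm p hp x => ?_
    have h := sum_braidCoeff_opE p hm (LinearMap.mk₂ ℂ
      (fun y z => cons y (cons z (tensorKSq n r x))) (by simp) (by simp) (by simp) (by simp))
    simp only [LinearMap.mk₂_apply] at h
    rw [Module.End.mul_apply, Module.End.mul_apply, tensorE_cons, tensorE_cons, tensorKSq_cons,
      opK_pow_u, sigmaOp_zero_cons_u_cons_u]
    simp only [map_add, map_smul, map_sum, LinearMap.smul_apply, sigmaOp_zero_cons_opE hm,
      sigmaOp_zero_cons_cons_opE m hp, sigmaOp_zero_cons_u_cons_u, tensorE_cons, tensorKSq_cons,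
      smul_add, Finset.sum_add_distrib, pow_succ' (opE r), Module.End.mul_apply,
      Nat.cast_ofNat] at h ⊢
    rw [← add_assoc, ← add_assoc, h]
  · refine hom_ext_cons_u fun m _ x => ?_
    have hK := LinearMap.congr_fun
      (commute_sigmaOp_tensorKSq (r := r) (n := n + 1) ⟨i, Nat.lt_of_succ_lt_succ hi⟩).eq x
    have hE := LinearMap.congr_fun ih.eq x
    simp only [Module.End.mul_apply] at hK hE ⊢
    simp only [tensorE_cons, map_add, sigmaOp_succ_cons, hK, hE]

theorem sigmaOp_zero_opKInv_sq [NeZero r] {m : ℕ} (p : ℕ) (hm : m < r) (x : TensorPow n r) :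
    sigmaOp (n + 2) r ⟨0, Nat.succ_pos n⟩
        (cons ((opKInv r ^ 2) (u r m)) (cons ((opKInv r ^ 2) (u r p)) x)) =
      ∑ a ∈ Finset.range r, braidCoeff r m p a • cons ((opKInv r ^ 2) ((opF r ^ a) (u r p)))
        (cons ((opKInv r ^ 2) ((opE r ^ a) (u r m))) x) := by
  simp only [opKInv_sq_u, map_smul, LinearMap.smul_apply, sigmaOp_zero_cons_u_cons_u,
    Finset.smul_sum]
  refine Finset.sum_congr rfl fun a _ => ?_
  rcases lt_or_ge m a with hma | hma
  · simp [opE_pow_u_eq_zero hma]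
  simp only [opKInv_sq_opF_pow_u, opE_pow_u hm, if_pos hma, opKInv_sq_u, map_smul,
    LinearMap.smul_apply, smul_smul, mul_assoc, mul_comm (braidCoeff r m p a)]
  rw [← mul_assoc, ← mul_assoc, ← zpow_add₀ (qHalf_ne_zero r), ← zpow_add₀ (qHalf_ne_zero r)]
  push_cast [hma]
  ring_nf

theorem commute_sigmaOp_tensorF [r.AtLeastTwo] (i : Fin (n - 1)) :
    Commute (sigmaOp n r i) (tensorF n r) := by
  refine crossing_induction (P := fun n i => Commute (sigmaOp n r i) (tensorF n r))
    (fun n => ?_) (fun n i hi ih => ?_) n i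
  · refine hom_ext_cons_u_cons_u fun m hm p _ x => ?_
    have h := sum_braidCoeff_opF p hm (LinearMap.mk₂ ℂ
      (fun y z => cons y (cons z x)) (by simp) (by simp) (by simp) (by simp))
    simp only [LinearMap.mk₂_apply] at h
    rw [Module.End.mul_apply, Module.End.mul_apply, tensorF_cons, tensorF_cons, map_add, map_add,
      map_add, sigmaOp_zero_opKInv_sq p hm, opKInv_sq_u, sigmaOp_zero_cons_u_cons_u]
    simp only [map_add, map_smul, map_sum, LinearMap.smul_apply, sigmaOp_zero_cons_opF,
      sigmaOp_zero_cons_cons_opF, tensorF_cons, smul_add, Finset.sum_add_distrib,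
      pow_succ' (opF r), Module.End.mul_apply] at h ⊢
    rw [← add_assoc, ← add_assoc, h]
  · refine hom_ext_cons_u fun m _ x => ?_
    have hF := LinearMap.congr_fun ih.eq x
    simp only [Module.End.mul_apply] at hF ⊢
    simp only [tensorF_cons, map_add, sigmaOp_succ_cons, hF]

/-! ### The braid relations -/

/-- `u_0` generates `V_{r-1}` under `F`. -/
theorem eq_of_commute_tensorF [NeZero r] {A B : Module.End ℂ (TensorPow (n + 1) r)}
    (hA : Commute A (tensorF (n + 1) r)) (hB : Commute B (tensorF (n + 1) r))
    (h : ∀ x, A (cons (u r 0) x) = B (cons (u r 0) x)) : A = B := by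
  refine hom_ext_cons_u fun m hm x => ?_
  induction m generalizing x with
  | zero => exact h x
  | succ m ih =>
    replace ih := ih (Nat.lt_of_succ_lt hm)
    have hF : A (tensorF (n + 1) r (cons (u r m) x)) = B (tensorF (n + 1) r (cons (u r m) x)) := by
      rw [← Module.End.mul_apply, ← Module.End.mul_apply, hA.eq, hB.eq, Module.End.mul_apply,
        Module.End.mul_apply, ih]
    simp only [tensorF_cons, opF_u, opKInv_sq_u, map_add, map_smul, LinearMap.smul_apply, ih,
      add_left_inj] at hF
    exact smul_right_injective _ (pow_ne_zero 2 (qInt_succ_ne_zero hm)) hF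

theorem sigmaOp_braid_zero [r.AtLeastTwo] :
    sigmaOp (n + 3) r ⟨0, Nat.succ_pos _⟩ * sigmaOp (n + 3) r ⟨1, Nat.succ_lt_succ n.succ_pos⟩ *
      sigmaOp (n + 3) r ⟨0, Nat.succ_pos _⟩ =
    sigmaOp (n + 3) r ⟨1, Nat.succ_lt_succ n.succ_pos⟩ * sigmaOp (n + 3) r ⟨0, Nat.succ_pos _⟩ *
      sigmaOp (n + 3) r ⟨1, Nat.succ_lt_succ n.succ_pos⟩ := by
  have h0 := commute_sigmaOp_tensorF (r := r) (n := n + 3) ⟨0, Nat.succ_pos _⟩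
  have h1 := commute_sigmaOp_tensorF (r := r) (n := n + 3) ⟨1, Nat.succ_lt_succ n.succ_pos⟩
  -- By equivariance it suffices to compare the two sides on `u_0 ⊗ u_m ⊗ u_p ⊗ x`.
  refine eq_of_commute_tensorF ((h0.mul_left h1).mul_left h0) ((h1.mul_left h0).mul_left h1) ?_
  simp only [← LinearMap.comp_apply, ← LinearMap.ext_iff]
  refine hom_ext_cons_u_cons_u fun m hm p _ x => ?_
  have hone (y : V r) (x : TensorPow (n + 2) r) :
      sigmaOp (n + 3) r ⟨1, Nat.succ_lt_succ n.succ_pos⟩ (cons y x) =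
      cons y (sigmaOp (n + 2) r ⟨0, Nat.succ_pos _⟩ x) := sigmaOp_succ_cons _ y x
  simp only [LinearMap.comp_apply, Module.End.mul_apply]
  rw [sigmaOp_zero_cons_u_zero, map_smul, map_smul, hone, hone, sigmaOp_zero_cons_u_zero, map_smul,
    map_smul]
  simp only [sigmaOp_zero_cons_u_cons_u, map_sum, map_smul, Finset.smul_sum]
  refine Finset.sum_congr rfl fun a _ => ?_
  rcases lt_or_ge m a with hma | hma
  · simp [opE_pow_u_eq_zero hma]
  have hexp : qHalf r ^ (-2 * ((r : ℤ) - 1) * m) * qHalf r ^ (-2 * ((r : ℤ) - 1) * p) =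
      qHalf r ^ (-2 * ((r : ℤ) - 1) * (p + a : ℕ)) *
        qHalf r ^ (-2 * ((r : ℤ) - 1) * (m - a : ℕ)) := by
    rw [← zpow_add₀ (qHalf_ne_zero r), ← zpow_add₀ (qHalf_ne_zero r)]
    push_cast [hma]
    ring_nf
  simp only [opF_pow_u, opE_pow_u hm, if_pos hma, map_smul, LinearMap.smul_apply,
    sigmaOp_zero_cons_u_zero, hone, smul_smul]
  congr 1
  linear_combination (braidCoeff r m p a * ∏ i ∈ Finset.range a, qInt r (p + i + 1) ^ 2) * hexp

theorem sigmaOp_braid [r.AtLeastTwo] (i : ℕ) (hi : i + 1 < n - 1) :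
    sigmaOp n r ⟨i, by omega⟩ * sigmaOp n r ⟨i + 1, hi⟩ * sigmaOp n r ⟨i, by omega⟩ =
    sigmaOp n r ⟨i + 1, hi⟩ * sigmaOp n r ⟨i, by omega⟩ * sigmaOp n r ⟨i + 1, hi⟩ := by
  induction i generalizing n with
  | zero =>
    obtain ⟨n, rfl⟩ : ∃ k, n = k + 3 := ⟨n - 3, by omega⟩
    exact sigmaOp_braid_zero
  | succ i ih =>
    obtain ⟨n, rfl⟩ : ∃ k, n = k + 2 := ⟨n - 2, by omega⟩
    refine hom_ext_cons_u fun m _ x => ?_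
    have h := LinearMap.congr_fun (ih (n := n + 1) (Nat.lt_of_succ_lt_succ hi)) x
    simp only [Module.End.mul_apply] at h ⊢
    simp only [sigmaOp_succ_cons, h]

theorem sigmaOp_comm [NeZero r] (i j : ℕ) (hij : i + 1 < j) (hj : j < n - 1) :
    sigmaOp n r ⟨i, by omega⟩ * sigmaOp n r ⟨j, hj⟩ =
      sigmaOp n r ⟨j, hj⟩ * sigmaOp n r ⟨i, by omega⟩ := by
  induction i generalizing n j with
  | zero =>
    obtain ⟨n, rfl⟩ : ∃ k, n = k + 4 := ⟨n - 4, by omega⟩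
    obtain ⟨j, rfl⟩ : ∃ k, j = k + 2 := ⟨j - 2, by omega⟩
    refine hom_ext_cons_u_cons_u fun m _ p _ x => ?_
    have hsigma (y z : V r) (x : TensorPow (n + 2) r) :
        sigmaOp (n + 4) r ⟨j + 2, hj⟩ (cons y (cons z x)) =
          cons y (cons z (sigmaOp (n + 2) r ⟨j, by omega⟩ x)) := by
      rw [sigmaOp_succ_cons, sigmaOp_succ_cons]
    simp only [Module.End.mul_apply, hsigma, sigmaOp_zero_cons_u_cons_u, map_sum, map_smul]
  | succ i ih =>
    obtain ⟨n, rfl⟩ : ∃ k, n = k + 2 := ⟨n - 2, by omega⟩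
    obtain ⟨j, rfl⟩ : ∃ k, j = k + 1 := ⟨j - 1, by omega⟩
    refine hom_ext_cons_u fun m _ x => ?_
    have h := LinearMap.congr_fun (ih (n := n + 1) j (by omega) (by omega)) x
    simp only [Module.End.mul_apply] at h ⊢
    simp only [sigmaOp_succ_cons, h]

/-! ### Invertibility of the braid operators -/

theorem eq_top_of_cons_u_mem {S : Submodule ℂ (TensorPow (n + 1) r)}
    (h : ∀ m < r, ∀ x, cons (u r m) x ∈ S) : S = ⊤ := by
  have hmkQ : S.mkQ = 0 := hom_ext_cons_u fun m hm x => by simpa using h m hm x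
  rw [← Submodule.ker_mkQ S, hmkQ, LinearMap.ker_zero]

theorem eq_top_of_tensorF_mem [NeZero r] {S : Submodule ℂ (TensorPow (n + 2) r)}
    (hF : ∀ v ∈ S, tensorF (n + 2) r v ∈ S) (h : ∀ m x, cons (u r m) (cons (u r 0) x) ∈ S) :
    S = ⊤ := by
  suffices hS : ∀ p < r, ∀ m x, cons (u r m) (cons (u r p) x) ∈ S by
    refine eq_top_of_cons_u_mem fun m _ x => ?_
    have hcomap : S.comap (cons (u r m)) = ⊤ := eq_top_of_cons_u_mem fun p hp x => hS p hp m x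
    exact hcomap.ge (Submodule.mem_top (x := x))
  intro p hp
  induction p with
  | zero => exact h
  | succ p ih =>
    intro m x
    replace ih := ih (Nat.lt_of_succ_lt hp)
    have hmem := hF _ (ih m x)
    simp only [tensorF_cons, opF_u, opKInv_sq_u, map_add, map_smul, LinearMap.smul_apply] at hmem
    replace hmem := (Submodule.add_mem_iff_right _ (Submodule.smul_mem _ _ (ih _ _))).1 hmem
    replace hmem := (Submodule.add_mem_iff_left _
      (Submodule.smul_mem _ _ (Submodule.smul_mem _ _ (ih _ _)))).1 hmem
    rwa [Submodule.smul_mem_iff _ (pow_ne_zero 2 (qInt_succ_ne_zero hp)),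
      Submodule.smul_mem_iff _ (zpow_ne_zero _ (qHalf_ne_zero r))] at hmem

theorem range_sigmaOp [r.AtLeastTwo] (i : Fin (n - 1)) : LinearMap.range (sigmaOp n r i) = ⊤ := by
  refine crossing_induction (P := fun n i => LinearMap.range (sigmaOp n r i) = ⊤)
    (fun n => ?_) (fun n i hi ih => ?_) n i
  · refine eq_top_of_tensorF_mem ?_ fun m x => ?_
    · rintro _ ⟨v, rfl⟩
      exact ⟨tensorF (n + 2) r v, LinearMap.congr_fun (commute_sigmaOp_tensorF _).eq v⟩
    · rw [← Submodule.smul_mem_iff _ (zpow_ne_zero (-2 * ((r : ℤ) - 1) * m) (qHalf_ne_zero r)),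
        ← sigmaOp_zero_cons_u_zero]
      exact LinearMap.mem_range_self _ _
  · refine eq_top_of_cons_u_mem fun m _ x => ?_
    obtain ⟨y, rfl⟩ := LinearMap.range_eq_top.1 ih x
    exact ⟨cons (u r m) y, sigmaOp_succ_cons hi _ y⟩

theorem isUnit_sigmaOp [r.AtLeastTwo] (i : Fin (n - 1)) : IsUnit (sigmaOp n r i) :=
  (LinearMap.isUnit_iff_range_eq_top _).2 (range_sigmaOp i)

end SigmaOp

/-! ### The full twist from the braid relations -/

section HalfTwist

variable {M : Type*} [Monoid M]

/-- The product `σ 0 * σ 1 * ⋯ * σ (k - 1)`, that is `δ_{k+1}` on the strands of `σ`. -/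
def ascProd (σ : ℕ → M) : ℕ → M
  | 0 => 1
  | k + 1 => ascProd σ k * σ k

/-- The product `σ (k - 1) * ⋯ * σ 1 * σ 0`, the reverse of `ascProd σ k`. -/
def descProd (σ : ℕ → M) : ℕ → M
  | 0 => 1
  | k + 1 => σ k * descProd σ k

/-- The half twist `Δ_{k+1} = δ_{k+1} δ_k ⋯ δ_2` in `σ 0, …, σ (k - 1)`; the index `k` is the number
of generators, one less than the number of strands. -/
def halfTwistProd (σ : ℕ → M) : ℕ → M
  | 0 => 1
  | k + 1 => ascProd σ (k + 1) * halfTwistProd σ k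

/-- The first `N` terms of the sequence `σ` satisfy the Artin relations of `B_{N+1}`. -/
structure ArtinRelations (σ : ℕ → M) (N : ℕ) : Prop where
  commute : ∀ i j, i + 1 < j → j < N → Commute (σ i) (σ j)
  braid : ∀ i, i + 1 < N → σ i * σ (i + 1) * σ i = σ (i + 1) * σ i * σ (i + 1)

theorem ascProd_succ' (σ : ℕ → M) (k : ℕ) :
    ascProd σ (k + 1) = σ 0 * ascProd (fun i => σ (i + 1)) k := by
  induction k with
  | zero => simp [ascProd]
  | succ k ih => rw [ascProd, ih, ascProd, mul_assoc]

theorem descProd_succ' (σ : ℕ → M) (k : ℕ) :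
    descProd σ (k + 1) = descProd (fun i => σ (i + 1)) k * σ 0 := by
  induction k with
  | zero => simp [descProd]
  | succ k ih => rw [descProd, ih, descProd, mul_assoc]

theorem ascProd_const (x : M) (k : ℕ) : ascProd (fun _ => x) k = x ^ k := by
  induction k with
  | zero => rw [ascProd, pow_zero]
  | succ k ih => rw [ascProd, ih, pow_succ]

theorem halfTwistProd_const (x : M) (k : ℕ) :
    halfTwistProd (fun _ => x) k = x ^ (k + 1).choose 2 := by
  induction k with
  | zero => simp [halfTwistProd]
  | succ k ih => rw [halfTwistProd, ih, ascProd_const, ← pow_add, Nat.choose_succ_succ' (k + 1),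
      Nat.choose_one_right]

theorem ascProd_eq_prod (σ : ℕ → M) (k : ℕ) : ascProd σ k = ((List.range k).map σ).prod := by
  induction k with
  | zero => simp [ascProd]
  | succ k ih => simp [ascProd, ih, List.range_succ]

theorem halfTwistProd_eq_prod (σ : ℕ → M) (k : ℕ) :
    halfTwistProd σ k = ((List.range k).map fun t => ascProd σ (k - t)).prod := by
  induction k with
  | zero => simp [halfTwistProd]
  | succ k ih =>
    rw [halfTwistProd, ih, List.range_succ_eq_map, List.map_cons, List.prod_cons, List.map_map]
    simp [Function.comp_def]

theorem commute_ascProd {σ : ℕ → M} {x : M} {k : ℕ} (h : ∀ i < k, Commute x (σ i)) :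
    Commute x (ascProd σ k) := by
  induction k with
  | zero => exact Commute.one_right x
  | succ k ih => exact (ih fun i hi => h i (Nat.lt_succ_of_lt hi)).mul_right (h k k.lt_succ_self)

theorem commute_halfTwistProd {σ : ℕ → M} {x : M} {k : ℕ} (h : ∀ i < k, Commute x (σ i)) :
    Commute x (halfTwistProd σ k) := by
  induction k with
  | zero => exact Commute.one_right x
  | succ k ih => exact (commute_ascProd h).mul_right (ih fun i hi => h i (Nat.lt_succ_of_lt hi))

namespace ArtinRelations

variable {σ : ℕ → M} {N : ℕ}

theorem ascProd_mul_gen (h : ArtinRelations σ N) {k i : ℕ} (hi : i < k) (hk : k < N) :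
    ascProd σ (k + 1) * σ i = σ (i + 1) * ascProd σ (k + 1) := by
  induction k with
  | zero => omega
  | succ k ih =>
    rcases Nat.lt_succ_iff_lt_or_eq.1 hi with hik | rfl
    · rw [ascProd, mul_assoc, ← (h.commute i (k + 1) (by omega) hk).eq, ← mul_assoc,
        ih hik (by omega), mul_assoc]
    · have hcomm : Commute (σ (i + 1)) (ascProd σ i) :=
        commute_ascProd fun t ht => (h.commute t (i + 1) (by omega) hk).symm
      calc ascProd σ (i + 2) * σ i = ascProd σ i * (σ i * σ (i + 1) * σ i) := by
            simp only [ascProd, mul_assoc]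
        _ = ascProd σ i * σ (i + 1) * (σ i * σ (i + 1)) := by
            rw [h.braid i hk]
            simp only [mul_assoc]
        _ = σ (i + 1) * ascProd σ (i + 2) := by
            rw [← hcomm.eq]
            simp only [ascProd, mul_assoc]

theorem ascProd_mul_ascProd (h : ArtinRelations σ N) {k j : ℕ} (hj : j ≤ k) (hk : k < N) :
    ascProd σ (k + 1) * ascProd σ j = ascProd (fun i => σ (i + 1)) j * ascProd σ (k + 1) := by
  induction j with
  | zero => simp [ascProd]
  | succ j ih =>
    rw [ascProd.eq_2 σ j, ← mul_assoc, ih (by omega), mul_assoc, h.ascProd_mul_gen hj hk,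
      ascProd.eq_2 _ j, mul_assoc]

theorem ascProd_mul_halfTwistProd (h : ArtinRelations σ N) {k j : ℕ} (hj : j ≤ k) (hk : k < N) :
    ascProd σ (k + 1) * halfTwistProd σ j =
      halfTwistProd (fun i => σ (i + 1)) j * ascProd σ (k + 1) := by
  induction j with
  | zero => simp [halfTwistProd]
  | succ j ih =>
    rw [halfTwistProd, ← mul_assoc, h.ascProd_mul_ascProd hj hk, mul_assoc, ih (by omega),
      halfTwistProd, mul_assoc]

theorem halfTwistProd_succ (h : ArtinRelations σ N) {k : ℕ} (hk : k < N) :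
    halfTwistProd σ (k + 1) = halfTwistProd σ k * descProd σ (k + 1) := by
  induction k with
  | zero => simp [halfTwistProd, ascProd, descProd]
  | succ k ih =>
    have hcomm : Commute (σ (k + 1)) (halfTwistProd σ k) :=
      commute_halfTwistProd fun t ht => (h.commute t (k + 1) (by omega) hk).symm
    calc halfTwistProd σ (k + 2)
        = ascProd σ (k + 1) * (σ (k + 1) * halfTwistProd σ k) * descProd σ (k + 1) := by
          rw [halfTwistProd, ih (by omega), ascProd]
          simp only [mul_assoc]
      _ = halfTwistProd σ (k + 1) * descProd σ (k + 2) := by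
          rw [hcomm.eq, halfTwistProd, descProd.eq_2 σ (k + 1)]
          simp only [mul_assoc]

theorem halfTwistProd_succ_sq (h : ArtinRelations σ N) {k : ℕ} (hk : k < N) :
    halfTwistProd σ (k + 1) ^ 2 = halfTwistProd (fun i => σ (i + 1)) k ^ 2 *
      (ascProd σ (k + 1) * descProd σ (k + 1)) := by
  have hshift := h.ascProd_mul_halfTwistProd le_rfl hk
  calc halfTwistProd σ (k + 1) ^ 2
      = ascProd σ (k + 1) * halfTwistProd σ k * halfTwistProd σ k * descProd σ (k + 1) := by
        rw [pow_two]
        nth_rewrite 2 [h.halfTwistProd_succ hk]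
        rw [halfTwistProd]
        simp only [mul_assoc]
    _ = halfTwistProd (fun i => σ (i + 1)) k * (ascProd σ (k + 1) * halfTwistProd σ k) *
        descProd σ (k + 1) := by
        rw [hshift, mul_assoc (halfTwistProd _ k), hshift]
    _ = halfTwistProd (fun i => σ (i + 1)) k ^ 2 *
        (ascProd σ (k + 1) * descProd σ (k + 1)) := by
        rw [hshift, pow_two]
        simp only [mul_assoc]

end ArtinRelations

theorem map_halfTwist {n : ℕ} (φ : BraidGroup n →* M) (σ : ℕ → M)
    (h : ∀ i, φ (BraidGroup.gen n i) = σ i) :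
    φ (BraidGroup.halfTwist n) = halfTwistProd σ (n - 1) := by
  rw [BraidGroup.halfTwist, halfTwistProd_eq_prod, map_list_prod, List.map_map]
  congr 1
  refine List.map_congr_left fun t _ => ?_
  rw [Function.comp_apply, BraidGroup.delta, map_list_prod, List.map_map, ascProd_eq_prod,
    show φ ∘ BraidGroup.gen n = σ ∘ Fin.val from funext h, ← List.map_map, List.map_take,
    List.map_coe_finRange_eq_range, List.take_range]
  congr 3
  omega

end HalfTwist

section FullTwistOrder

/-- The homomorphism `B_n → ℤ` sending every Artin generator to `1`. -/
def exponentSum (n : ℕ) : BraidGroup n →* Multiplicative ℤ :=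
  PresentedGroup.toGroup (f := fun _ => Multiplicative.ofAdd 1) <| by
    rintro x (⟨i, j, _, rfl⟩ | ⟨i, j, _, rfl⟩) <;> simp

theorem exponentSum_fullTwist (n : ℕ) : exponentSum n (BraidGroup.fullTwist n) =
    Multiplicative.ofAdd 1 ^ ((n - 1 + 1).choose 2 * 2) := by
  rw [BraidGroup.fullTwist, map_pow, map_halfTwist (exponentSum n)
    (fun _ => Multiplicative.ofAdd 1) fun _ => PresentedGroup.toGroup.of _,
    halfTwistProd_const, ← pow_mul]

theorem fullTwist_pow_ne_one {n r : ℕ} (hn : 2 ≤ n) (hr : r ≠ 0) :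
    BraidGroup.fullTwist n ^ r ≠ 1 := fun h => by
  have hchoose : 0 < (n - 1 + 1).choose 2 := Nat.choose_pos (by omega)
  have hsum := congrArg (fun g => (exponentSum n g).toAdd) h
  simp [exponentSum_fullTwist, hchoose.ne', hr] at hsum

end FullTwistOrder

/-! ### The braid group representation -/

section BraidRep

variable {n r : ℕ}

theorem lift_sigmaOp_eq_one [r.AtLeastTwo] : ∀ x ∈ braidRels n,
    FreeGroup.lift (fun i => (isUnit_sigmaOp (n := n) (r := r) i).unit) x = 1 := by
  rintro x (⟨i, j, hij, rfl⟩ | ⟨i, j, hij, rfl⟩)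
  · rw [map_mul, map_inv, mul_inv_eq_one]
    apply Units.ext
    simpa using sigmaOp_comm i j hij j.2
  · rw [map_mul, map_inv, mul_inv_eq_one]
    apply Units.ext
    have hi : (i : ℕ) + 1 < n - 1 := hij ▸ j.2
    obtain rfl : j = ⟨i + 1, hi⟩ := Fin.ext hij.symm
    simpa using sigmaOp_braid i hi

/-- The representation of `B_n` on `V_{r-1}^{⊗ n}` in which the Artin generators act by the
operators `sigmaOp`. -/
noncomputable def braidRep (n r : ℕ) [r.AtLeastTwo] :
    Representation ℂ (BraidGroup n) (TensorPow n r) :=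
  (Units.coeHom _).comp (PresentedGroup.toGroup lift_sigmaOp_eq_one)

theorem braidRep_gen [r.AtLeastTwo] (i : Fin (n - 1)) :
    braidRep n r (BraidGroup.gen n i) = sigmaOp n r i := by
  rw [braidRep, BraidGroup.gen, MonoidHom.comp_apply, PresentedGroup.toGroup.of]
  rfl

theorem commute_braidRep [r.AtLeastTwo] {A : Module.End ℂ (TensorPow n r)}
    (hA : ∀ i, Commute (sigmaOp n r i) A) (g : BraidGroup n) : Commute (braidRep n r g) A := by
  have hg : g ∈ Subgroup.closure (Set.range (PresentedGroup.of (rels := braidRels n))) := by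
    simp only [PresentedGroup.closure_range_of, Subgroup.mem_top]
  induction hg using Subgroup.closure_induction with
  | mem g hg =>
    obtain ⟨i, rfl⟩ := hg
    have hi := hA i
    rwa [← braidRep_gen] at hi
  | one => exact (map_one (braidRep n r)).symm ▸ Commute.one_left A
  | mul g h _ _ hg hh => exact (map_mul (braidRep n r) g h).symm ▸ hg.mul_left hh
  | inv g _ hg =>
    rw [braidRep, MonoidHom.comp_apply, map_inv]
    exact Commute.units_inv_left hg

/-- The operators `sigmaOp n r i`, extended by `1` to all `i : ℕ`. -/
noncomputable def sigmaNat (n r i : ℕ) : Module.End ℂ (TensorPow n r) :=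
  if h : i < n - 1 then sigmaOp n r ⟨i, h⟩ else 1

theorem sigmaNat_of_lt {i : ℕ} (h : i < n - 1) : sigmaNat n r i = sigmaOp n r ⟨i, h⟩ :=
  dif_pos h

theorem artinRelations_sigmaNat [r.AtLeastTwo] : ArtinRelations (sigmaNat n r) (n - 1) where
  commute i j hij hj := by
    rw [sigmaNat_of_lt hj, sigmaNat_of_lt (by omega)]
    exact sigmaOp_comm i j hij hj
  braid i hi := by
    rw [sigmaNat_of_lt hi, sigmaNat_of_lt (by omega)]
    exact sigmaOp_braid i hi

theorem commute_sigmaNat_tensorF [r.AtLeastTwo] (i : ℕ) :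
    Commute (sigmaNat n r i) (tensorF n r) := by
  rw [sigmaNat]
  split_ifs
  · exact commute_sigmaOp_tensorF _
  · exact Commute.one_left _

theorem sigmaNat_succ_cons {i : ℕ} (y : V r) (x : TensorPow n r) :
    sigmaNat (n + 1) r (i + 1) (cons y x) = cons y (sigmaNat n r i x) := by
  by_cases h : i < n - 1
  · obtain ⟨n, rfl⟩ : ∃ k, n = k + 1 := ⟨n - 1, by omega⟩
    rw [sigmaNat_of_lt h, sigmaNat_of_lt (Nat.succ_lt_succ h)]
    exact sigmaOp_succ_cons _ y x
  · rw [sigmaNat, sigmaNat, dif_neg h, dif_neg (by omega)]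
    rfl

theorem ascProd_sigmaNat_cons (k : ℕ) (y : V r) (x : TensorPow n r) :
    ascProd (fun i => sigmaNat (n + 1) r (i + 1)) k (cons y x) =
      cons y (ascProd (sigmaNat n r) k x) := by
  induction k generalizing x with
  | zero => rfl
  | succ k ih => simp only [ascProd, Module.End.mul_apply, sigmaNat_succ_cons, ih]

theorem descProd_sigmaNat_cons (k : ℕ) (y : V r) (x : TensorPow n r) :
    descProd (fun i => sigmaNat (n + 1) r (i + 1)) k (cons y x) =
      cons y (descProd (sigmaNat n r) k x) := by
  induction k with
  | zero => rfl
  | succ k ih => simp only [descProd, Module.End.mul_apply, sigmaNat_succ_cons, ih]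

theorem halfTwistProd_sigmaNat_cons (k : ℕ) (y : V r) (x : TensorPow n r) :
    halfTwistProd (fun i => sigmaNat (n + 1) r (i + 1)) k (cons y x) =
      cons y (halfTwistProd (sigmaNat n r) k x) := by
  induction k with
  | zero => rfl
  | succ k ih => simp only [halfTwistProd, Module.End.mul_apply, ascProd_sigmaNat_cons, ih]

/-- The operator by which the full twist `θ_n` acts on `V_{r-1}^{⊗ n}`. -/
noncomputable def fullTwistOp (n r : ℕ) : Module.End ℂ (TensorPow n r) :=
  halfTwistProd (sigmaNat n r) (n - 1) ^ 2

theorem braidRep_fullTwist [r.AtLeastTwo] :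
    braidRep n r (BraidGroup.fullTwist n) = fullTwistOp n r := by
  rw [BraidGroup.fullTwist, map_pow, fullTwistOp, map_halfTwist (braidRep n r) (sigmaNat n r)]
  intro i
  rw [braidRep_gen, sigmaNat_of_lt i.2]

theorem commute_fullTwistOp_tensorF [r.AtLeastTwo] : Commute (fullTwistOp n r) (tensorF n r) :=
  (commute_halfTwistProd fun i _ => (commute_sigmaNat_tensorF i).symm).symm.pow_left 2

/-- The operator on `V_{r-1}^{⊗ (n+1)}` by which the first strand winds once around the `n` others,
so that `θ_{n+1} = (1 ⊗ θ_n) ∘ windOp n`. -/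
noncomputable def windOp (n r : ℕ) : Module.End ℂ (TensorPow (n + 1) r) :=
  ascProd (sigmaNat (n + 1) r) n * descProd (sigmaNat (n + 1) r) n

theorem windOp_succ_apply {y : V r} {v : TensorPow (n + 2) r} {x : TensorPow (n + 1) r}
    (h : sigmaOp (n + 2) r ⟨0, Nat.succ_pos n⟩ v = cons y x) :
    windOp (n + 1) r v = sigmaOp (n + 2) r ⟨0, Nat.succ_pos n⟩ (cons y (windOp n r x)) := by
  have hzero : sigmaNat (n + 2) r 0 = sigmaOp (n + 2) r ⟨0, Nat.succ_pos n⟩ := sigmaNat_of_lt _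
  rw [windOp, ascProd_succ', descProd_succ', hzero]
  simp only [Module.End.mul_apply, h, descProd_sigmaNat_cons, ascProd_sigmaNat_cons, windOp]

theorem exists_fullTwistOp_succ_eq_mul_windOp [r.AtLeastTwo] :
    ∃ A : Module.End ℂ (TensorPow (n + 1) r),
      (∀ y x, A (cons y x) = cons y (fullTwistOp n r x)) ∧
        fullTwistOp (n + 1) r = A * windOp n r := by
  refine ⟨halfTwistProd (fun i => sigmaNat (n + 1) r (i + 1)) (n - 1) ^ 2, fun y x => ?_, ?_⟩
  · simp only [fullTwistOp, pow_two, Module.End.mul_apply, halfTwistProd_sigmaNat_cons]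
  · cases n with
    | zero => simp [fullTwistOp, halfTwistProd, windOp, ascProd, descProd]
    | succ n => exact artinRelations_sigmaNat.halfTwistProd_succ_sq n.lt_succ_self

end BraidRep

/-! ### The full twist in terms of `E` and `F` -/

theorem sum_range_sum_range_eq_sum_antidiagonal {M : Type*} [AddCommMonoid M] {r : ℕ}
    {f : ℕ → ℕ → M} (hf : ∀ a b, r ≤ a + b → f a b = 0) :
    ∑ a ∈ Finset.range r, ∑ b ∈ Finset.range r, f a b =
      ∑ c ∈ Finset.range r, ∑ p ∈ Finset.HasAntidiagonal.antidiagonal c, f p.1 p.2 := by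
  simp only [Finset.Nat.sum_antidiagonal_eq_sum_range_succ f]
  rw [Finset.sum_range_diag_flip]
  refine Finset.sum_congr rfl fun a _ =>
    (Finset.sum_subset (Finset.range_mono (Nat.sub_le r a)) fun b _ hb => hf a b ?_).symm
  rw [Finset.mem_range] at hb
  omega

/-- The coefficient of `F^c u_0 ⊗ E^c x` in `windOp n r (u_0 ⊗ x)`, for `x` of degree `ℓ`. -/
noncomputable def windCoeff (r n : ℕ) (ℓ : ℤ) (c : ℕ) : ℂ :=
  qNum r 1 ^ (2 * c) / qNumFactorial r c *
    qHalf r ^ (2 * ((r : ℤ) - 1) * (c - 2 * ℓ - n * c) + 4 * ℓ * c - 3 * c ^ 2 - c)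

/-- The coefficient of `F^a E^a` in the full twist of `n` strands on vectors of degree `ℓ`. -/
noncomputable def twistCoeff (r n : ℕ) (ℓ : ℤ) (a : ℕ) : ℂ :=
  qNum r 1 ^ (2 * a) / qNumFactorial r a *
    qHalf r ^ (2 * ((r : ℤ) - 1) * (n * (a - 2 * ℓ)) + a ^ 2 + 3 * a - 4 * ℓ * a + 4 * ℓ * (ℓ - 1))

/-- The operator `∑_a t_a F^a E^a`, with `t_a = twistCoeff r n ℓ a`, by which the full twist acts on
vectors of degree `ℓ`. -/
noncomputable def twistSum (n r : ℕ) (ℓ : ℤ) : Module.End ℂ (TensorPow n r) :=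
  ∑ a ∈ Finset.range r, twistCoeff r n ℓ a • (tensorF n r ^ a * tensorE n r ^ a)

section FullTwistOp

variable {n r : ℕ} {ℓ : ℤ}

theorem windCoeff_zero (n : ℕ) : windCoeff r n 0 0 = 1 := by
  simp [windCoeff, qNumFactorial_zero]

theorem windCoeff_mul_braidCoeff [NeZero r] (m ℓ : ℤ) {a b : ℕ} (h : a + b < r) :
    qHalf r ^ (-2 * ((r : ℤ) - 1) * m) * (windCoeff r n ℓ b * braidCoeff r m b a) =
      windCoeff r (n + 1) (m + ℓ) (a + b) * (gaussBinom (q r ^ 2) a b *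
        qHalf r ^ (2 * (a : ℤ) * (n * ((r : ℤ) - 1) - 2 * ℓ))) := by
  have ha := qNumFactorial_ne_zero (show a < r by omega)
  have hb := qNumFactorial_ne_zero (show b < r by omega)
  have hab := qNumFactorial_ne_zero h
  have hexp : qHalf r ^ (-2 * ((r : ℤ) - 1) * m) *
      (qHalf r ^ (2 * ((r : ℤ) - 1) * (b - 2 * ℓ - n * b) + 4 * ℓ * b - 3 * b ^ 2 - b) *
      qHalf r ^ ((a : ℤ) * (a - 1) - 2 * (r - 1) * (m + b) + 4 * (m - a) * (b + a))) =
      qHalf r ^ (2 * ((r : ℤ) - 1) * ((a + b : ℕ) - 2 * (m + ℓ) - (n + 1 : ℕ) * (a + b : ℕ)) +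
        4 * (m + ℓ) * (a + b : ℕ) - 3 * ((a + b : ℕ) : ℤ) ^ 2 - (a + b : ℕ)) *
      (qHalf r ^ (2 * (a : ℤ) * b) *
        qHalf r ^ (2 * (a : ℤ) * (n * ((r : ℤ) - 1) - 2 * ℓ))) := by
    simp only [← zpow_add₀ (qHalf_ne_zero r)]
    push_cast
    congr 1
    ring
  rw [gaussBinom_q_sq h, windCoeff, windCoeff, braidCoeff]
  field_simp
  linear_combination (qNum r 1 ^ (2 * (a + b))) * hexp

theorem windCoeff_mul_twistCoeff [NeZero r] (ℓ : ℤ) {a b : ℕ} (h : a + b < r) :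
    windCoeff r n ℓ b * twistCoeff r n (ℓ - b) a = twistCoeff r (n + 1) ℓ (a + b) *
      (gaussBinom (q r ^ 2) a b * qHalf r ^ (-2 * (a : ℤ) * ((r : ℤ) - 1 - 2 * (0 : ℕ)))) := by
  have ha := qNumFactorial_ne_zero (show a < r by omega)
  have hb := qNumFactorial_ne_zero (show b < r by omega)
  have hab := qNumFactorial_ne_zero h
  have hexp : qHalf r ^ (2 * ((r : ℤ) - 1) * (b - 2 * ℓ - n * b) + 4 * ℓ * b - 3 * b ^ 2 - b) *
      qHalf r ^ (2 * ((r : ℤ) - 1) * (n * (a - 2 * (ℓ - b))) + a ^ 2 + 3 * a - 4 * (ℓ - b) * a +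
        4 * (ℓ - b) * (ℓ - b - 1)) =
      qHalf r ^ (2 * ((r : ℤ) - 1) * ((n + 1 : ℕ) * ((a + b : ℕ) - 2 * ℓ)) + ((a + b : ℕ) : ℤ) ^ 2 +
        3 * (a + b : ℕ) - 4 * ℓ * (a + b : ℕ) + 4 * ℓ * (ℓ - 1)) *
      (qHalf r ^ (2 * (a : ℤ) * b) * qHalf r ^ (-2 * (a : ℤ) * ((r : ℤ) - 1 - 2 * (0 : ℕ)))) := by
    simp only [← zpow_add₀ (qHalf_ne_zero r)]
    push_cast
    congr 1
    ring
  rw [gaussBinom_q_sq h, windCoeff, twistCoeff, twistCoeff]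
  field_simp
  linear_combination (qNum r 1 ^ (2 * (a + b))) * hexp

theorem twistCoeff_add_twistCoeff_succ [r.AtLeastTwo] (n : ℕ) (ℓ : ℤ) {a : ℕ} (ha : a + 1 < r) :
    twistCoeff r n (ℓ + 1) a + twistCoeff r n (ℓ + 1) (a + 1) *
      (qInt r (a + 1) * qInt r (n * ((r : ℤ) - 1) - 2 * ℓ + a)) = twistCoeff r n ℓ a := by
  have hone := qNum_one_ne_zero (r := r)
  have hsucc : qNum r (a + 1) ≠ 0 := qNum_ne_zero (by omega) (by omega)
  have hfact := qNumFactorial_ne_zero (show a < r by omega)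
  have hcancel : twistCoeff r n (ℓ + 1) (a + 1) *
      (qInt r (a + 1) * qInt r (n * ((r : ℤ) - 1) - 2 * ℓ + a)) =
      qNum r 1 ^ (2 * a) / qNumFactorial r a *
        (qHalf r ^ (2 * ((r : ℤ) - 1) * (n * ((a + 1 : ℕ) - 2 * (ℓ + 1))) + (a + 1 : ℕ) ^ 2 +
          3 * (a + 1 : ℕ) - 4 * (ℓ + 1) * (a + 1 : ℕ) + 4 * (ℓ + 1) * (ℓ + 1 - 1)) *
          qNum r (n * ((r : ℤ) - 1) - 2 * ℓ + a)) := by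
    rw [twistCoeff, qNumFactorial_succ, qInt, qInt]
    field_simp
    ring
  rw [hcancel, twistCoeff, twistCoeff, ← mul_add, qNum_eq r (_ + _), mul_sub (qHalf r ^ _),
    ← zpow_add₀ (qHalf_ne_zero r), ← zpow_add₀ (qHalf_ne_zero r)]
  push_cast
  ring_nf

theorem sigmaOp_zero_cons_opF_pow [NeZero r] (m b : ℕ) (x : TensorPow n r) :
    sigmaOp (n + 2) r ⟨0, Nat.succ_pos n⟩ (cons (u r m) (cons ((opF r ^ b) (u r 0)) x)) =
      ∑ a ∈ Finset.range r, braidCoeff r m b a •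
        cons ((opF r ^ (a + b)) (u r 0)) (cons ((opE r ^ a) (u r m)) x) := by
  simp only [pow_add, Module.End.mul_apply]
  simp only [opF_pow_u r 0 b, zero_add, map_smul, LinearMap.smul_apply, sigmaOp_zero_cons_u_cons_u,
    Finset.smul_sum, smul_comm (braidCoeff r m b _)]

theorem windOp_cons_u_zero [NeZero r] {x : TensorPow n r} (hx : x ∈ degreeSpace n r ℓ) :
    windOp n r (cons (u r 0) x) = ∑ c ∈ Finset.range r, windCoeff r n ℓ c •
      cons ((opF r ^ c) (u r 0)) ((tensorE n r ^ c) x) := by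
  refine (degreeSpace_induction (S := fun n ℓ => LinearMap.eqLocus (windOp n r ∘ₗ cons (u r 0))
    (∑ c ∈ Finset.range r, windCoeff r n ℓ c •
      cons ((opF r ^ c) (u r 0)) ∘ₗ (tensorE n r ^ c))) (fun x => ?_)
    (fun n ℓ m _ x hx ih => ?_) hx).trans (by simp)
  · rw [LinearMap.mem_eqLocus, Finset.sum_eq_single_of_mem 0 (by simp [NeZero.pos])]
    · simp [windOp, ascProd, descProd, windCoeff_zero]
    · intro c _ hc
      simp [tensorE_zero_left, hc]
  simp only [LinearMap.mem_eqLocus, LinearMap.comp_apply, LinearMap.sum_apply,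
    LinearMap.smul_apply] at ih ⊢
  rw [windOp_succ_apply (x := cons (u r 0) x) (y := qHalf r ^ (-2 * ((r : ℤ) - 1) * m) • u r m)
    (by rw [sigmaOp_zero_cons_u_zero, map_smul, LinearMap.smul_apply]), ih]
  simp only [map_smul, map_sum, LinearMap.smul_apply, sigmaOp_zero_cons_opF_pow,
    tensorE_pow_cons _ hx, Finset.smul_sum]
  rw [Finset.sum_comm, sum_range_sum_range_eq_sum_antidiagonal]
  · refine Finset.sum_congr rfl fun c hc => Finset.sum_congr rfl fun p hp => ?_
    rw [Finset.HasAntidiagonal.mem_antidiagonal] at hp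
    rw [Finset.mem_range] at hc
    have hcoeff := windCoeff_mul_braidCoeff (n := n) m ℓ (a := p.1) (b := p.2) (hp ▸ hc)
    rw [hp] at hcoeff
    simp only [smul_smul]
    rw [← hcoeff, hp, mul_left_comm]
  · intro a b hab
    simp [opF_pow_u_eq_zero (show r ≤ 0 + (a + b) by omega)]

theorem tensorE_pow_cons_u_zero (x : TensorPow n r) (a : ℕ) :
    (tensorE (n + 1) r ^ a) (cons (u r 0) x) = cons (u r 0) ((tensorE n r ^ a) x) := by
  induction a with
  | zero => rfl
  | succ a ih => simp [pow_succ', ih, tensorE_cons, opE_u_zero]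

theorem fullTwistOp_cons_u_zero [r.AtLeastTwo]
    (hθ : ∀ ℓ, ∀ x ∈ degreeSpace n r ℓ, fullTwistOp n r x = twistSum n r ℓ x)
    {x : TensorPow n r} (hx : x ∈ degreeSpace n r ℓ) :
    fullTwistOp (n + 1) r (cons (u r 0) x) = twistSum (n + 1) r ℓ (cons (u r 0) x) := by
  obtain ⟨A, hA, hθA⟩ := exists_fullTwistOp_succ_eq_mul_windOp (n := n) (r := r)
  have hθE (c : ℕ) : fullTwistOp n r ((tensorE n r ^ c) x) = ∑ d ∈ Finset.range r,
      twistCoeff r n (ℓ - c) d • (tensorF n r ^ d) ((tensorE n r ^ (d + c)) x) := by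
    rw [hθ _ _ (tensorE_pow_mem hx c)]
    simp [twistSum, pow_add]
  rw [hθA, Module.End.mul_apply, windOp_cons_u_zero hx]
  simp only [map_sum, map_smul, hA, hθE, Finset.smul_sum, twistSum, LinearMap.sum_apply,
    LinearMap.smul_apply, Module.End.mul_apply, tensorE_pow_cons_u_zero, tensorF_pow_cons]
  rw [Finset.sum_comm, sum_range_sum_range_eq_sum_antidiagonal]
  · refine Finset.sum_congr rfl fun c hc => Finset.sum_congr rfl fun p hp => ?_
    rw [Finset.HasAntidiagonal.mem_antidiagonal] at hp
    rw [Finset.mem_range] at hc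
    have hcoeff := windCoeff_mul_twistCoeff (n := n) ℓ (a := p.1) (b := p.2) (hp ▸ hc)
    rw [hp] at hcoeff
    simp only [smul_smul]
    rw [hcoeff, hp, mul_assoc]
  · intro a b hab
    simp [pow_eq_zero_of_le hab (tensorE_pow_self n r)]

/-- The terms with `a + 1 = r` that the two sides do not share vanish because `F^r = 0`. -/
theorem twistSum_tensorF [r.AtLeastTwo] {x : TensorPow n r} (hx : x ∈ degreeSpace n r ℓ) :
    twistSum n r (ℓ + 1) (tensorF n r x) = tensorF n r (twistSum n r ℓ x) := by
  obtain ⟨t, ht⟩ : ∃ t, r = t + 1 := ⟨r - 1, (Nat.succ_pred (NeZero.ne r)).symm⟩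
  have hrange : Finset.range r = Finset.range (t + 1) := by rw [ht]
  have hF : tensorF n r ^ (t + 1) = 0 := ht ▸ tensorF_pow_self n r
  have hshift : ∑ a ∈ Finset.range t, twistCoeff r n (ℓ + 1) (a + 1) •
      (tensorF n r ^ (a + 2)) ((tensorE n r ^ (a + 1)) x) +
        twistCoeff r n (ℓ + 1) 0 • tensorF n r x =
      ∑ a ∈ Finset.range t, twistCoeff r n (ℓ + 1) a •
        (tensorF n r ^ (a + 1)) ((tensorE n r ^ a) x) := by
    have h := Finset.sum_range_succ' (fun a => twistCoeff r n (ℓ + 1) a •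
      (tensorF n r ^ (a + 1)) ((tensorE n r ^ a) x)) t
    rw [Finset.sum_range_succ, hF, LinearMap.zero_apply, smul_zero, add_zero] at h
    simpa using h.symm
  have hcoeff (a : ℕ) (ha : a ∈ Finset.range t) :=
    twistCoeff_add_twistCoeff_succ n ℓ (show a + 1 < r by simpa [ht] using ha)
  have hright : tensorF n r (twistSum n r ℓ x) = ∑ a ∈ Finset.range t,
      twistCoeff r n ℓ a • (tensorF n r ^ (a + 1)) ((tensorE n r ^ a) x) := by
    simp only [twistSum, LinearMap.sum_apply, LinearMap.smul_apply, Module.End.mul_apply, map_sum,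
      map_smul, ← Module.End.mul_apply (tensorF n r), ← pow_succ']
    rw [hrange, Finset.sum_range_succ, hF, LinearMap.zero_apply, smul_zero, add_zero]
  have hleft : twistSum n r (ℓ + 1) (tensorF n r x) = ∑ a ∈ Finset.range t,
      twistCoeff r n (ℓ + 1) (a + 1) • (tensorF n r ^ (a + 1))
        ((tensorE n r ^ (a + 1)) (tensorF n r x)) +
      twistCoeff r n (ℓ + 1) 0 • tensorF n r x := by
    simp only [twistSum, LinearMap.sum_apply, LinearMap.smul_apply, Module.End.mul_apply]
    rw [hrange, Finset.sum_range_succ']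
    simp
  rw [hleft, hright]
  simp only [tensorE_pow_tensorF hx, map_add, map_smul, smul_add, smul_smul,
    Finset.sum_add_distrib, ← Module.End.mul_apply (tensorF n r ^ _) (tensorF n r), ← pow_succ]
  rw [add_right_comm, hshift, ← Finset.sum_add_distrib]
  exact Finset.sum_congr rfl fun a ha => by rw [← add_smul, hcoeff a ha]

theorem fullTwistOp_cons_u [r.AtLeastTwo]
    (hθ : ∀ ℓ, ∀ x ∈ degreeSpace n r ℓ, fullTwistOp n r x = twistSum n r ℓ x)
    {m : ℕ} (hm : m < r) {x : TensorPow n r} (hx : x ∈ degreeSpace n r ℓ) :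
    fullTwistOp (n + 1) r (cons (u r m) x) = twistSum (n + 1) r (m + ℓ) (cons (u r m) x) := by
  induction m generalizing ℓ x with
  | zero => simpa using fullTwistOp_cons_u_zero hθ hx
  | succ m ih =>
    have hm' : m < r := by omega
    have hFcons : tensorF (n + 1) r (cons (u r m) x) ∈ LinearMap.eqLocus
        (fullTwistOp (n + 1) r) (twistSum (n + 1) r (m + ℓ + 1)) := by
      rw [LinearMap.mem_eqLocus, twistSum_tensorF (cons_mem_degreeSpace hm' hx), ← ih hm' hx]
      exact LinearMap.congr_fun commute_fullTwistOp_tensorF.eq _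
    have hconsF : cons (u r m) (tensorF n r x) ∈ LinearMap.eqLocus
        (fullTwistOp (n + 1) r) (twistSum (n + 1) r (m + ℓ + 1)) := by
      rw [add_assoc]
      exact ih hm' (tensorF_mem hx)
    simp only [tensorF_cons, opF_u, opKInv_sq_u, map_smul, LinearMap.smul_apply] at hFcons
    rw [Submodule.add_mem_iff_left _ (Submodule.smul_mem _ _ hconsF),
      Submodule.smul_mem_iff _ (pow_ne_zero 2 (qInt_succ_ne_zero hm))] at hFcons
    rw [Nat.cast_succ, add_right_comm]
    exact hFcons

theorem fullTwistOp_apply [r.AtLeastTwo] {x : TensorPow n r} (hx : x ∈ degreeSpace n r ℓ) :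
    fullTwistOp n r x = twistSum n r ℓ x := by
  induction n generalizing ℓ with
  | zero =>
    refine Submodule.span_le (p := LinearMap.eqLocus (fullTwistOp 0 r) (twistSum 0 r ℓ)) |>.2 ?_ hx
    rintro _ ⟨ε, rfl, rfl⟩
    rw [SetLike.mem_coe, LinearMap.mem_eqLocus, twistSum, LinearMap.sum_apply,
      Finset.sum_eq_single_of_mem 0 (by simp [NeZero.pos])]
    · simp [fullTwistOp, halfTwistProd, twistCoeff, qNumFactorial_zero]
    · intro a _ ha
      simp [tensorE_zero_left, ha]
  | succ n ih =>
    refine degreeSpace_succ_le (S := LinearMap.eqLocus (fullTwistOp (n + 1) r)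
      (twistSum (n + 1) r ℓ)) (fun m hm y hy => ?_) hx
    simpa using fullTwistOp_cons_u (fun _ _ => ih) hm hy

end FullTwistOp

/-! ### The full twist on the dominant space -/

section QNumSum

theorem sum_prod_one_sub_pow_div {K : Type*} [Field K] (Q : K) (J : ℕ)
    (hQ : ∀ a < J, Q ^ (a + 1) ≠ 1) :
    ∑ a ∈ Finset.range J, (∏ i ∈ Finset.range (a + 1), (1 - Q ^ (J - i))) / (1 - Q ^ (a + 1)) =
      J := by
  induction J with
  | zero => simp
  | succ J ih =>
    have hvanish : ∏ i ∈ Finset.range (J + 1), (1 - Q ^ (J - i)) = 0 := by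
      rw [Finset.prod_range_succ]
      simp
    have htelescope (a : ℕ) (ha : a ∈ Finset.range (J + 1)) :
        (∏ i ∈ Finset.range (a + 1), (1 - Q ^ (J + 1 - i))) / (1 - Q ^ (a + 1)) =
        (∏ i ∈ Finset.range (a + 1), (1 - Q ^ (J - i))) / (1 - Q ^ (a + 1)) +
        (∏ i ∈ Finset.range a, (1 - Q ^ (J - i)) -
          ∏ i ∈ Finset.range (a + 1), (1 - Q ^ (J - i))) := by
      rw [Finset.mem_range] at ha
      have hne : 1 - Q ^ (a + 1) ≠ 0 := sub_ne_zero.2 (hQ a ha).symm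
      have hpow : Q ^ (J - a) * Q ^ (a + 1) = Q ^ (J + 1) := by
        rw [← pow_add]
        congr 1
        omega
      rw [Finset.prod_range_succ', Finset.prod_range_succ, Nat.sub_zero, ← hpow]
      simp only [Nat.add_sub_add_right]
      field_simp
      ring
    rw [Finset.sum_congr rfl htelescope, Finset.sum_add_distrib, Finset.sum_range_sub',
      Finset.sum_range_succ, ih fun a ha => hQ a (by omega), hvanish]
    simp

theorem qNum_natCast (r x : ℕ) :
    qNum r x = qHalf r ^ (2 * (x : ℤ)) * (1 - (qHalf r ^ (-4 : ℤ)) ^ x) := by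
  rw [qNum_eq, mul_sub, mul_one, ← zpow_natCast, ← zpow_mul, ← zpow_add₀ (qHalf_ne_zero r)]
  ring_nf

theorem prod_qNum_sub (r : ℕ) {J b : ℕ} (hb : b ≤ J) :
    ∏ i ∈ Finset.range b, qNum r ((J : ℤ) - i) = qHalf r ^ (2 * (J : ℤ) * b - b * (b - 1)) *
      ∏ i ∈ Finset.range b, (1 - (qHalf r ^ (-4 : ℤ)) ^ (J - i)) := by
  have hqNum (i : ℕ) (hi : i ∈ Finset.range b) : qNum r ((J : ℤ) - i) =
      qHalf r ^ (2 * ((J : ℤ) - i)) * (1 - (qHalf r ^ (-4 : ℤ)) ^ (J - i)) := by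
    rw [← Nat.cast_sub ((Finset.mem_range.1 hi).le.trans hb), qNum_natCast]
  have hpow : ∏ i ∈ Finset.range b, qHalf r ^ (2 * ((J : ℤ) - i)) =
      qHalf r ^ (2 * (J : ℤ) * b - b * (b - 1)) := by
    clear hb hqNum
    induction b with
    | zero => simp
    | succ b ih =>
      rw [Finset.prod_range_succ, ih, ← zpow_add₀ (qHalf_ne_zero r)]
      push_cast
      ring_nf
  rw [Finset.prod_congr rfl hqNum, Finset.prod_mul_distrib, hpow]

theorem sum_range_succ_prod_qNum_div {r : ℕ} [NeZero r] {j : ℕ} (hj : j + 1 < r) :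
    ∑ a ∈ Finset.range (j + 1), qHalf r ^ (((a : ℤ) + 1) * (a - 2 * j)) *
      (∏ i ∈ Finset.range a, qNum r (j - i)) / qNum r (a + 1) = (j + 1) / qNum r (j + 1) := by
  have h0 := qHalf_ne_zero r
  have hne (a : ℕ) (ha : a < j + 1) : qNum r (a + 1) ≠ 0 := qNum_ne_zero (by omega) (by omega)
  have hQ (a : ℕ) (ha : a < j + 1) : 1 - (qHalf r ^ (-4 : ℤ)) ^ (a + 1) ≠ 0 :=
    right_ne_zero_of_mul (a := qHalf r ^ (2 * ((a + 1 : ℕ) : ℤ)))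
      (by rw [← qNum_natCast]; exact_mod_cast hne a ha)
  have hsum := sum_prod_one_sub_pow_div (qHalf r ^ (-4 : ℤ)) (j + 1)
    fun a ha => (sub_ne_zero.1 (hQ a ha)).symm
  rw [eq_div_iff (hne j (Nat.lt_succ_self j)), Finset.sum_mul]
  refine .trans (Finset.sum_congr rfl fun a ha => ?_) (hsum.trans (by push_cast; rfl))
  rw [Finset.mem_range] at ha
  have hprod : (∏ i ∈ Finset.range a, qNum r ((j : ℤ) - i)) * qNum r (j + 1) =
      ∏ i ∈ Finset.range (a + 1), qNum r ((j + 1 : ℕ) - i) := by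
    rw [Finset.prod_range_succ']
    simp
  have hsucc := qNum_natCast r (a + 1)
  push_cast at hsucc
  have hexp : ((a : ℤ) + 1) * (a - 2 * j) +
      (2 * (j + 1 : ℕ) * (a + 1 : ℕ) - (a + 1 : ℕ) * ((a + 1 : ℕ) - 1)) - 2 * (a + 1) = 0 := by
    push_cast
    ring
  rw [div_mul_eq_mul_div, mul_assoc, hprod, prod_qNum_sub r ha, hsucc, ← mul_assoc,
    ← zpow_add₀ h0, mul_div_mul_comm, ← zpow_sub₀ h0, hexp, zpow_zero, one_mul]

theorem sum_prod_qNum_div {r : ℕ} [NeZero r] {j : ℕ} (hj : j + 1 < r) :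
    ∑ a ∈ Finset.range (r - 1), qHalf r ^ (((a : ℤ) + 1) * (a - 2 * j)) *
      (∏ i ∈ Finset.range a, qNum r (j - i)) / qNum r (a + 1) = (j + 1) / qNum r (j + 1) := by
  rw [← sum_range_succ_prod_qNum_div hj]
  refine (Finset.sum_subset (Finset.range_mono (by omega)) fun a _ ha => ?_).symm
  rw [Finset.prod_eq_zero (i := j) (by simpa using ha) (by simp)]
  simp

theorem qNum_add_mul {r : ℕ} [NeZero r] (x t : ℤ) :
    qNum r (x + r * t) = qHalf r ^ (2 * r * t) * qNum r x := by
  have h := qHalf_zpow_add_four_mul (r := r) (-(2 * (x + r * t))) t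
  rw [qNum_eq, qNum_eq, mul_sub, ← zpow_add₀ (qHalf_ne_zero r), ← zpow_add₀ (qHalf_ne_zero r), ← h]
  ring_nf

theorem prod_neg_qInt_mul_qInt {r : ℕ} [r.AtLeastTwo] (j : ℕ) (t : ℤ) (a : ℕ) :
    ∏ i ∈ Finset.range a, -(qInt r (i + 1) * qInt r (-j + r * t + i)) =
      (qHalf r ^ (2 * r * t)) ^ a * qNumFactorial r a *
        (∏ i ∈ Finset.range a, qNum r (j - i)) / qNum r 1 ^ (2 * a) := by
  have hone := qNum_one_ne_zero (r := r)
  induction a with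
  | zero => simp
  | succ a ih =>
    rw [Finset.prod_range_succ, ih, show -(j : ℤ) + r * t + a = -(j - a) + r * t by ring, qInt,
      qInt, qNum_add_mul, qNum_neg, qNumFactorial_succ, Finset.prod_range_succ]
    field_simp
    ring

end QNumSum

section TwistSum

variable {n r : ℕ} {ℓ : ℤ} {x : TensorPow n r}

theorem tensorF_pow_tensorE_pow_apply [r.AtLeastTwo] (hx : x ∈ degreeSpace n r ℓ) (a : ℕ) :
    (tensorF n r ^ (a + 2)) ((tensorE n r ^ (a + 2)) x) =
      (tensorF n r ^ (a + 1)) ((tensorE n r ^ (a + 1)) (tensorF n r (tensorE n r x))) -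
      (qInt r (a + 1) * qInt r (n * ((r : ℤ) - 1) - 2 * (ℓ - 1) + a)) •
        (tensorF n r ^ (a + 1)) ((tensorE n r ^ (a + 1)) x) := by
  rw [tensorE_pow_tensorF (tensorE_mem hx), map_add, map_smul, pow_succ (tensorF n r) (a + 1),
    pow_succ (tensorE n r) (a + 1), pow_succ (tensorE n r) a]
  simp only [Module.End.mul_apply, add_sub_cancel_right]

theorem tensorF_pow_tensorE_pow_apply_eq_zero [r.AtLeastTwo] (hx : x ∈ degreeSpace n r ℓ)
    (h : tensorF n r (tensorE n r x) = 0) (a : ℕ) :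
    (tensorF n r ^ (a + 1)) ((tensorE n r ^ (a + 1)) x) = 0 := by
  induction a with
  | zero => simpa using h
  | succ a ih =>
    rw [tensorF_pow_tensorE_pow_apply hx, h, ih, map_zero, map_zero, smul_zero, sub_zero]

theorem tensorF_pow_tensorE_pow_apply_eq_smul [r.AtLeastTwo] (hx : x ∈ degreeSpace n r ℓ)
    (h : tensorF n r (tensorE n r (tensorF n r (tensorE n r x))) = 0) (a : ℕ) :
    (tensorF n r ^ (a + 1)) ((tensorE n r ^ (a + 1)) x) =
      (∏ i ∈ Finset.range a, -(qInt r (i + 1) *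
        qInt r (n * ((r : ℤ) - 1) - 2 * (ℓ - 1) + i))) • tensorF n r (tensorE n r x) := by
  induction a with
  | zero => simp
  | succ a ih =>
    have hFE : tensorF n r (tensorE n r x) ∈ degreeSpace n r ℓ := by
      simpa using tensorF_mem (tensorE_mem hx)
    rw [tensorF_pow_tensorE_pow_apply hx, tensorF_pow_tensorE_pow_apply_eq_zero hFE h, ih,
      Finset.prod_range_succ, smul_smul, zero_sub, ← neg_smul, mul_comm (∏ _ ∈ _, _), neg_mul]

/-- Compare `E^r = 0` with the nonzero multiple of `FE` that `F^r E^r` is on `ker (FE)²`. -/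
theorem tensorF_tensorE_apply_eq_zero_of_dvd [r.AtLeastTwo] (hx : x ∈ degreeSpace n r ℓ)
    (h : tensorF n r (tensorE n r (tensorF n r (tensorE n r x))) = 0)
    (hr : (r : ℤ) ∣ n + 2 * ℓ - 1) : tensorF n r (tensorE n r x) = 0 := by
  have hpow := tensorF_pow_tensorE_pow_apply_eq_smul hx h (r - 1)
  rw [Nat.sub_add_cancel NeZero.one_le, tensorE_pow_self, LinearMap.zero_apply, map_zero] at hpow
  refine (smul_eq_zero.1 hpow.symm).resolve_left (Finset.prod_ne_zero_iff.2 fun i hi => ?_)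
  rw [Finset.mem_range] at hi
  have hi' : ¬(r : ℤ) ∣ i + 1 := fun hd => by
    have := Int.le_of_dvd (by omega) hd
    omega
  have hweight : ¬(r : ℤ) ∣ n * ((r : ℤ) - 1) - 2 * (ℓ - 1) + i := fun hd => hi' <| by
    have hsum := dvd_sub (dvd_add hd hr) (dvd_mul_left (r : ℤ) n)
    rwa [show n * ((r : ℤ) - 1) - 2 * (ℓ - 1) + i + (n + 2 * ℓ - 1) - n * r = (i : ℤ) + 1 by
      ring] at hsum
  exact neg_ne_zero.2 (mul_ne_zero (mt (qInt_eq_zero_iff _).1 hi')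
    (mt (qInt_eq_zero_iff _).1 hweight))

theorem twistCoeff_zero [NeZero r] (n : ℕ) (ℓ : ℤ) :
    twistCoeff r n ℓ 0 = q r ^ (2 * ℓ * (n + ℓ - 1)) := by
  rw [q_zpow, ← qHalf_zpow_add_four_mul _ (-(n * ℓ)), twistCoeff, qNumFactorial_zero, mul_zero,
    pow_zero, div_one, one_mul, Nat.cast_zero]
  ring_nf

theorem twistSum_apply_of_tensorF_tensorE_eq_zero [r.AtLeastTwo] (hx : x ∈ degreeSpace n r ℓ)
    (h : tensorF n r (tensorE n r x) = 0) :
    twistSum n r ℓ x = q r ^ (2 * ℓ * (n + ℓ - 1)) • x := by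
  rw [twistSum, LinearMap.sum_apply, Finset.sum_eq_single_of_mem 0 (by simp [NeZero.pos]),
    twistCoeff_zero]
  · simp
  · intro a _ ha
    obtain ⟨a, rfl⟩ := Nat.exists_eq_succ_of_ne_zero ha
    rw [LinearMap.smul_apply, Module.End.mul_apply, tensorF_pow_tensorE_pow_apply_eq_zero hx h,
      smul_zero]

theorem twistCoeff_succ_mul_prod [r.AtLeastTwo] {j : ℕ} {t : ℤ}
    (ht : n * ((r : ℤ) - 1) - 2 * (ℓ - 1) = -j + r * t) {a : ℕ} (ha : a + 1 < r) :
    twistCoeff r n ℓ (a + 1) *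
      (∏ i ∈ Finset.range a, -(qInt r (i + 1) *
        qInt r (n * ((r : ℤ) - 1) - 2 * (ℓ - 1) + i))) =
      twistCoeff r n ℓ 0 * (qHalf r ^ (2 * r * t) * qNum r 1 ^ 2) *
        (qHalf r ^ (((a : ℤ) + 1) * (a - 2 * j)) *
          (∏ i ∈ Finset.range a, qNum r (j - i)) / qNum r (a + 1)) := by
  have hone := qNum_one_ne_zero (r := r)
  have hsucc : qNum r (a + 1) ≠ 0 := qNum_ne_zero (by omega) (by omega)
  have hfact := qNumFactorial_ne_zero (show a < r by omega)
  have hexp : qHalf r ^ (2 * ((r : ℤ) - 1) * (n * ((a + 1 : ℕ) - 2 * ℓ)) +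
      ((a + 1 : ℕ) : ℤ) ^ 2 + 3 * (a + 1 : ℕ) - 4 * ℓ * (a + 1 : ℕ) + 4 * ℓ * (ℓ - 1)) *
      (qHalf r ^ (2 * r * t)) ^ a =
      qHalf r ^ (2 * ((r : ℤ) - 1) * (n * ((0 : ℕ) - 2 * ℓ)) +
      ((0 : ℕ) : ℤ) ^ 2 + 3 * (0 : ℕ) - 4 * ℓ * (0 : ℕ) + 4 * ℓ * (ℓ - 1)) *
      (qHalf r ^ (2 * r * t) * qHalf r ^ (((a : ℤ) + 1) * (a - 2 * j))) := by
    rw [← zpow_natCast (qHalf r ^ _) a, ← zpow_mul]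
    simp only [← zpow_add₀ (qHalf_ne_zero r)]
    rw [← qHalf_zpow_add_four_mul _ (-(t * a))]
    congr 1
    push_cast
    linear_combination (2 * ((a : ℤ) + 1)) * ht
  rw [ht, prod_neg_qInt_mul_qInt, twistCoeff, twistCoeff, qNumFactorial_succ, qNumFactorial_zero]
  field_simp
  linear_combination (qNum r 1 ^ (2 * a + 2) * ∏ i ∈ Finset.range a, qNum r (j - i)) * hexp

theorem twistSum_apply [r.AtLeastTwo] (hx : x ∈ degreeSpace n r ℓ)
    (h : tensorF n r (tensorE n r (tensorF n r (tensorE n r x))) = 0) {j : ℕ} {t : ℤ}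
    (ht : n * ((r : ℤ) - 1) - 2 * (ℓ - 1) = -j + r * t) (hj : j + 1 < r) :
    twistSum n r ℓ x = q r ^ (2 * ℓ * (n + ℓ - 1)) • (x + (qHalf r ^ (2 * r * t) * (j + 1) *
      (qNum r 1 ^ 2 / qNum r (j + 1))) • tensorF n r (tensorE n r x)) := by
  have hrange : Finset.range r = Finset.range (r - 1 + 1) := by
    rw [Nat.sub_add_cancel NeZero.one_le]
  have hcoeff (a : ℕ) (ha : a ∈ Finset.range (r - 1)) := twistCoeff_succ_mul_prod (n := n) ht
    (show a + 1 < r by have := Finset.mem_range.1 ha; omega)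
  rw [twistSum, LinearMap.sum_apply, hrange, Finset.sum_range_succ']
  simp only [LinearMap.smul_apply, Module.End.mul_apply,
    tensorF_pow_tensorE_pow_apply_eq_smul hx h, smul_smul]
  rw [← Finset.sum_smul, Finset.sum_congr rfl hcoeff, ← Finset.mul_sum, sum_prod_qNum_div hj,
    twistCoeff_zero, pow_zero, pow_zero, Module.End.one_apply, Module.End.one_apply]
  module

end TwistSum

/-! ### The subrepresentations `W_{n,ℓ}` and `N_{n,ℓ}` -/

section Subrepresentations

variable {n r ℓ : ℕ}

theorem braidRep_mem_ker [r.AtLeastTwo] {A : Module.End ℂ (TensorPow n r)}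
    (hA : ∀ i, Commute (sigmaOp n r i) A) (g : BraidGroup n) {v : TensorPow n r}
    (hv : v ∈ LinearMap.ker A) : braidRep n r g v ∈ LinearMap.ker A := by
  rw [LinearMap.mem_ker, ← Module.End.mul_apply, ← (commute_braidRep hA g).eq,
    Module.End.mul_apply, hv, map_zero]

theorem braidRep_mem_weightSpace [r.AtLeastTwo] (g : BraidGroup n) {v : TensorPow n r}
    (hv : v ∈ weightSpace n r ℓ) : braidRep n r g v ∈ weightSpace n r ℓ :=
  braidRep_mem_ker (fun i => Commute.sub_right (R := Module.End ℂ (TensorPow n r))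
    (commute_sigmaOp_tensorH i) ((Commute.one_right _).smul_right _)) g hv

/-- The subrepresentation `W_{n,ℓ}` of `V_{r-1}^{⊗ n}`. -/
noncomputable def highestWeightSubrep (n r ℓ : ℕ) [r.AtLeastTwo] :
    Subrepresentation (braidRep n r) where
  toSubmodule := highestWeightSpace n r ℓ
  apply_mem_toSubmodule g _ hv :=
    ⟨braidRep_mem_ker commute_sigmaOp_tensorE g hv.1, braidRep_mem_weightSpace g hv.2⟩

/-- The subrepresentation `N_{n,ℓ}` of `V_{r-1}^{⊗ n}`. -/
noncomputable def dominantSubrep (n r ℓ : ℕ) [r.AtLeastTwo] :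
    Subrepresentation (braidRep n r) where
  toSubmodule := dominantSpace n r ℓ
  apply_mem_toSubmodule g _ hv :=
    ⟨braidRep_mem_ker (fun i =>
      ((commute_sigmaOp_tensorF i).mul_right (commute_sigmaOp_tensorE i)).pow_right 2) g hv.1,
      braidRep_mem_weightSpace g hv.2⟩

theorem mem_degreeSpace_of_mem_dominantSpace {v : TensorPow n r} (hv : v ∈ dominantSpace n r ℓ) :
    v ∈ degreeSpace n r ℓ :=
  weightSpace_eq_degreeSpace n r ℓ ▸ hv.2

theorem tensorF_tensorE_sq_apply_of_mem_dominantSpace {v : TensorPow n r}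
    (hv : v ∈ dominantSpace n r ℓ) :
    tensorF n r (tensorE n r (tensorF n r (tensorE n r v))) = 0 := by
  simpa [pow_two] using hv.1

theorem braidRep_fullTwist_apply_of_tensorF_tensorE_eq_zero [r.AtLeastTwo] {v : TensorPow n r}
    (hv : v ∈ weightSpace n r ℓ) (h : tensorF n r (tensorE n r v) = 0) :
    braidRep n r (BraidGroup.fullTwist n) v = q r ^ (2 * (ℓ : ℤ) * (n + ℓ - 1)) • v := by
  rw [weightSpace_eq_degreeSpace] at hv
  rw [braidRep_fullTwist, fullTwistOp_apply hv, twistSum_apply_of_tensorF_tensorE_eq_zero hv h]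

theorem braidRep_fullTwist_apply_of_mem_highestWeightSpace [r.AtLeastTwo] {v : TensorPow n r}
    (hv : v ∈ highestWeightSpace n r ℓ) :
    braidRep n r (BraidGroup.fullTwist n) v = q r ^ (2 * (ℓ : ℤ) * (n + ℓ - 1)) • v :=
  braidRep_fullTwist_apply_of_tensorF_tensorE_eq_zero hv.2 <| by
    rw [LinearMap.mem_ker.1 hv.1, map_zero]

theorem tensorF_tensorE_apply_eq_zero_of_mem_dominantSpace [r.AtLeastTwo] {v : TensorPow n r}
    (hv : v ∈ dominantSpace n r ℓ) (h : (r : ℤ) ∣ n + 2 * ℓ - 1) :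
    tensorF n r (tensorE n r v) = 0 :=
  tensorF_tensorE_apply_eq_zero_of_dvd (mem_degreeSpace_of_mem_dominantSpace hv)
    (tensorF_tensorE_sq_apply_of_mem_dominantSpace hv) h

theorem s_pow_mul_q_zpow [NeZero r] {x t : ℤ} (ht : n * ((r : ℤ) - 1) + x = r * t) :
    s r ^ n * q r ^ x = qHalf r ^ (2 * r * t) := by
  have hs : s r = q r ^ ((r : ℤ) - 1) := by
    rw [s, ← zpow_natCast, Nat.cast_sub NeZero.one_le, Nat.cast_one]
  rw [hs, ← zpow_natCast, ← zpow_mul, q_zpow, q_zpow, ← zpow_add₀ (qHalf_ne_zero r), ← mul_add,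
    mul_comm _ (n : ℤ), ht, mul_assoc]

theorem braidRep_fullTwist_apply_of_mem_dominantSpace [r.AtLeastTwo] {j : ℕ} {ℓ' : ℤ}
    (hj : (j : ℤ) ≡ n + 2 * ((ℓ : ℤ) - 1) [ZMOD r]) (hjr : j + 1 < r)
    (hℓ' : ℓ' = (ℓ : ℤ) - 1 - j) {v : TensorPow n r} (hv : v ∈ dominantSpace n r ℓ) :
    braidRep n r (BraidGroup.fullTwist n) v = q r ^ (2 * (ℓ : ℤ) * (n + ℓ - 1)) •
      (v + (s r ^ n * q r ^ (1 - (ℓ : ℤ) - ℓ') * ((ℓ : ℤ) - ℓ' : ℤ) *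
        (qNum r 1 ^ 2 / qNum r (ℓ - ℓ'))) • tensorF n r (tensorE n r v)) := by
  have hdeg := mem_degreeSpace_of_mem_dominantSpace hv
  obtain ⟨c, hc⟩ := Int.modEq_iff_dvd.1 hj
  have hsign : s r ^ n * q r ^ (1 - (ℓ : ℤ) - ℓ') = qHalf r ^ (2 * r * (n - c)) :=
    s_pow_mul_q_zpow (by rw [hℓ']; linear_combination -hc)
  rw [braidRep_fullTwist, fullTwistOp_apply hdeg,
    twistSum_apply hdeg (tensorF_tensorE_sq_apply_of_mem_dominantSpace hv)
      (show _ = -(j : ℤ) + r * (n - c) by linear_combination -hc) hjr,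
    hsign, show (ℓ : ℤ) - ℓ' = j + 1 by rw [hℓ']; ring]
  push_cast
  rfl

theorem q_zpow_pow_eq_one [NeZero r] {x : ℤ} (hx : Even x) : (q r ^ x) ^ r = 1 := by
  obtain ⟨y, rfl⟩ := hx
  rw [q_zpow, ← zpow_natCast, ← zpow_mul, qHalf_zpow_eq_one_iff]
  exact ⟨y, by ring⟩

theorem highestWeightSubrep_fullTwist_pow [r.AtLeastTwo] :
    (highestWeightSubrep n r ℓ).toRepresentation (BraidGroup.fullTwist n ^ r) = 1 := by
  have hscalar : (highestWeightSubrep n r ℓ).toRepresentation (BraidGroup.fullTwist n) =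
      q r ^ (2 * (ℓ : ℤ) * (n + ℓ - 1)) • 1 :=
    LinearMap.ext fun v => Subtype.ext (braidRep_fullTwist_apply_of_mem_highestWeightSpace v.2)
  rw [map_pow, hscalar, smul_pow, one_pow, q_zpow_pow_eq_one (by simp [mul_assoc]), one_smul]

theorem highestWeightSubrep_not_injective [r.AtLeastTwo] (hn : 2 ≤ n) :
    ¬Function.Injective (highestWeightSubrep n r ℓ).toRepresentation := fun hinj =>
  fullTwist_pow_ne_one hn (NeZero.ne r)
    (hinj (highestWeightSubrep_fullTwist_pow.trans (map_one _).symm))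

end Subrepresentations

end Steinberg

open Steinberg in
theorem mainTheorem2 (n r ℓ j : ℕ) (ℓ' : ℤ) (hn : 1 ≤ n) (hr : 2 ≤ r) (hjr : j < r)
    (hj : (j : ℤ) ≡ n + 2 * ((ℓ : ℤ) - 1) [ZMOD r]) (hℓ' : ℓ' = (ℓ : ℤ) - 1 - j) :
    ∃ ρ : Representation ℂ (BraidGroup n) (TensorPow n r),
      (∀ i, ρ (BraidGroup.gen n i) = sigmaOp n r i) ∧
      ∃ W N : Subrepresentation ρ,
        W.toSubmodule = highestWeightSpace n r ℓ ∧
        N.toSubmodule = dominantSpace n r ℓ ∧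
        -- the formula for the full twist on `N_{n,ℓ}`
        (j < r - 1 → ∀ v ∈ dominantSpace n r ℓ,
          ρ (BraidGroup.fullTwist n) v =
            q r ^ (2 * (ℓ : ℤ) * (n + ℓ - 1)) •
              (v + (s r ^ n * q r ^ (1 - (ℓ : ℤ) - ℓ') * ((ℓ : ℤ) - ℓ' : ℤ) *
                (qNum r 1 ^ 2 / qNum r (ℓ - ℓ'))) • tensorF n r (tensorE n r v))) ∧
        -- if `j = r - 1`, then `{ℓ - ℓ'} = {r} = 0` and `FE` vanishes on `N_{n,ℓ}`
        (j = r - 1 → ∀ v ∈ dominantSpace n r ℓ,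
          tensorF n r (tensorE n r v) = 0 ∧
          ρ (BraidGroup.fullTwist n) v = q r ^ (2 * (ℓ : ℤ) * (n + ℓ - 1)) • v) ∧
        -- the full twist acts on `W_{n,ℓ}` by a root of unity
        (∀ v ∈ highestWeightSpace n r ℓ,
          ρ (BraidGroup.fullTwist n) v = q r ^ (2 * (ℓ : ℤ) * (n + ℓ - 1)) • v) ∧
        (q r ^ (2 * (ℓ : ℤ) * (n + ℓ - 1))) ^ r = 1 ∧
        W.toRepresentation (BraidGroup.fullTwist n ^ r) = 1 ∧
        (2 ≤ n → ¬ Function.Injective W.toRepresentation) := by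
  have : r.AtLeastTwo := ⟨hr⟩
  refine ⟨braidRep n r, braidRep_gen, highestWeightSubrep n r ℓ, dominantSubrep n r ℓ, rfl, rfl,
    fun hlt v hv => braidRep_fullTwist_apply_of_mem_dominantSpace hj (by omega) hℓ' hv,
    fun heq v hv => ?_, fun v hv => braidRep_fullTwist_apply_of_mem_highestWeightSpace hv,
    q_zpow_pow_eq_one (by simp [mul_assoc]), highestWeightSubrep_fullTwist_pow,
    highestWeightSubrep_not_injective⟩
  have hdvd : (r : ℤ) ∣ n + 2 * ℓ - 1 := by
    obtain ⟨c, hc⟩ := Int.modEq_iff_dvd.1 hj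
    have hjr' : (j : ℤ) = r - 1 := by omega
    exact ⟨c + 1, by linear_combination hc + hjr'⟩
  have hFE := tensorF_tensorE_apply_eq_zero_of_mem_dominantSpace hv hdvd
  exact ⟨hFE, braidRep_fullTwist_apply_of_tensorF_tensorE_eq_zero hv.2 hFE⟩
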